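/- **Proposition (Dependence of $\varphi$ on $(\beta,B)$ via $h^*$).** Let $\tau\in(2,3)$ and let $P=(P_k)_{k\ge 0}$ be a probability distribution on the non-negative integers having strongly finite mean with exponent $\tau$, i.e. there is a constant $c>0$ with $\sum_{i\ge k}P_i\le c\,k^{-(\tau-1)}$ for all $k\ge 1$. Let $\overline P=\sum_k kP_k$, which is finite, assume $\overline P>0$, and let $\rho_k=(k+1)P_{k+1}/\overline P$, $k\ge 0$, be the size-biased law of $P$. For $\beta,B>0$ let $h^*=h^*(\beta,B)$ be the fixed point supported on $[0,\infty)$ of the distributional recursion $$h\stackrel{d}{=}B+\sum_{i=1}^{K}\operatorname{atanh}\bigl(\tanh(\beta)\tanh(h_i)\bigr),$$ where $K$ has law $\rho$ and $h_1,h_2,\dots$ are i.i.d. copies of $h$ independent of $K$. For a random variable $h\geq 0$ put $$\varphi_h(\beta,B)=\frac{\overline P}{2}\log\cosh(\beta)-\frac{\overline P}{2}\,\mathbb E\bigl[\log(1+\tanh(\beta)\tanh(h_1)\tanh(h_2))\bigr]+\mathbb E\Bigl[\log\Bigl(e^{B}\prod_{i=1}^{L}\{1+\tanh(\beta)\tanh(h_i)\}+e^{-B}\prod_{i=1}^{L}\{1-\tanh(\beta)\tanh(h_i)\}\Bigr)\Bigr],$$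 where $L$ has law $P$, $h_1,h_2,\dots$ are i.i.d. copies of $h$, and $L$ and $(h_i)_{i\ge1}$ are independent. (a) For all $B>0$ and $\beta_{\min}>0$ there is a constant $\lambda_1<\infty$ such that for all $\beta_1,\beta_2\ge\beta_{\min}$, with $h_1^*=h^*(\beta_1,B)$ and $h_2^*=h^*(\beta_2,B)$, $$|\varphi_{h_1^*}(\beta_1,B)-\varphi_{h_2^*}(\beta_1,B)|\le\lambda_1|\beta_1-\beta_2|^{\tau-1}.$$ (b) For all $\beta>0$ and $B_{\min}>0$ there is a constant $\lambda_2<\infty$ such that for all $B_1,B_2\ge B_{\min}$, with $h_1^*=h^*(\beta,B_1)$ and $h_2^*=h^*(\beta,B_2)$, $$|\varphi_{h_1^*}(\beta,B_1)-\varphi_{h_2^*}(\beta,B_1)|\le\lambda_2|B_1-B_2|^{\tau-1}.$$ -/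

import Mathlib

open MeasureTheory

noncomputable section

namespace RandomIsing

/-- The mean of a probability distribution `P` on `ℕ`. -/
def degMean (P : PMF ℕ) : ℝ := ∑' k : ℕ, (k : ℝ) * (P k).toReal

/-- `P` has strongly finite mean with exponent `τ`: for some `c > 0`,
`∑_{i ≥ k} P_i ≤ c k^{-(τ - 1)}` for all `k ≥ 1`. -/
def StronglyFiniteMean (P : PMF ℕ) (τ : ℝ) : Prop :=
  ∃ c : ℝ, 0 < c ∧ ∀ k : ℕ, 1 ≤ k →
    ∑' i : ℕ, (P (k + i)).toReal ≤ c * (k : ℝ) ^ (-(τ - 1))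

/-- The size-biased weights `ρ_k = (k + 1) P_{k + 1} / mean(P)`. -/
def sizeBiasedWeight (P : PMF ℕ) (k : ℕ) : ℝ :=
  ((k : ℝ) + 1) * (P (k + 1)).toReal / degMean P

/-- The size-biased law `ρ` as a measure on `ℕ`. It is a probability measure as soon as `P` has
finite positive mean. -/
def sizeBiased (P : PMF ℕ) : Measure ℕ :=
  Measure.sum fun k : ℕ => ENNReal.ofReal (sizeBiasedWeight P k) • Measure.dirac k

/-- The law of an i.i.d. sequence `h 0, h 1, …` with common law `ν`. -/
def iidLaw (ν : Measure ℝ) : Measure (ℕ → ℝ) := Measure.infinitePi fun _ : ℕ => ν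

/-- `B + ∑_{i < k} atanh (tanh β tanh h_i)`, as a function of `(k, h)`. -/
def treeStep (β B : ℝ) (x : ℕ × (ℕ → ℝ)) : ℝ :=
  B + ∑ i ∈ Finset.range x.1, Real.artanh (Real.tanh β * Real.tanh (x.2 i))

/-- One step of the distributional recursion: the law of
`B + ∑_{i < K} atanh (tanh β tanh h_i)`, where `K` has the size-biased law of `P`, the `h_i` are
i.i.d. with law `ν`, and `K` is independent of the `h_i`. -/
def treeRecursion (P : PMF ℕ) (β B : ℝ) (ν : Measure ℝ) : Measure ℝ :=
  ((sizeBiased P).prod (iidLaw ν)).map (treeStep β B)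

/-- `ν` is the law of the fixed point `h^*(β, B)`: a probability distribution supported on
`[0, ∞)` and invariant under the distributional recursion. -/
structure IsTreeFixedPoint (P : PMF ℕ) (β B : ℝ) (ν : Measure ℝ) : Prop where
  isProbabilityMeasure : IsProbabilityMeasure ν
  nonneg : ∀ᵐ h ∂ν, 0 ≤ h
  fixed : treeRecursion P β B ν = ν

/-- `log (1 + tanh β tanh h₁ tanh h₂)`. -/
def edgeTerm (β : ℝ) (h : ℝ × ℝ) : ℝ :=
  Real.log (1 + Real.tanh β * Real.tanh h.1 * Real.tanh h.2)

/-- `log (e^B ∏_{i < ℓ} (1 + tanh β tanh h_i) + e^{-B} ∏_{i < ℓ} (1 - tanh β tanh h_i))`,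
as a function of `(ℓ, h)`. -/
def vertexTerm (β B : ℝ) (x : ℕ × (ℕ → ℝ)) : ℝ :=
  Real.log
    (Real.exp B * ∏ i ∈ Finset.range x.1, (1 + Real.tanh β * Real.tanh (x.2 i)) +
      Real.exp (-B) * ∏ i ∈ Finset.range x.1, (1 - Real.tanh β * Real.tanh (x.2 i)))

/-- The pressure functional `φ_h(β, B)` of the random Bethe lattice, where `h` has law `ν`:
`L` has law `P`, the `h_i` are i.i.d. with law `ν`, and `L` is independent of the `h_i`. -/
def pressure (P : PMF ℕ) (ν : Measure ℝ) (β B : ℝ) : ℝ :=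
  degMean P / 2 * Real.log (Real.cosh β)
    - degMean P / 2 * ∫ h, edgeTerm β h ∂(ν.prod ν)
    + ∫ x, vertexTerm β B x ∂(P.toMeasure.prod (iidLaw ν))

/-! The definitions above are meaningful: the mean is finite, the size-biased law is a probability
measure, the recursion map is measurable, and both expectations in the pressure are finite. -/

theorem StronglyFiniteMean.summable {P : PMF ℕ} {τ : ℝ} (hτ : 2 < τ)
    (hP : StronglyFiniteMean P τ) : Summable fun k : ℕ => (k : ℝ) * (P k).toReal := by
  obtain ⟨c, hc, h⟩ := hP
  have hs : Summable fun k => (P k).toReal := ENNReal.summable_toReal P.tsum_coe_ne_top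
  have hpow : Summable fun k : ℕ => c * ((k : ℝ) + 1) ^ (-(τ - 1)) := by
    have := (Real.summable_nat_rpow (p := -(τ - 1))).2 (by linarith)
    have := ((summable_nat_add_iff 1).2 this).mul_left c
    simpa using this
  have htail : ∀ n : ℕ, ∑ k ∈ Finset.range n, (k : ℝ) * (P k).toReal ≤
      ∑' k : ℕ, c * ((k : ℝ) + 1) ^ (-(τ - 1)) := by
    intro n
    calc ∑ k ∈ Finset.range n, (k : ℝ) * (P k).toReal
        = ∑ k ∈ Finset.range n, ∑ j ∈ Finset.range n, if j < k then (P k).toReal else 0 := by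
          refine Finset.sum_congr rfl fun k hk => ?_
          rw [← Finset.sum_filter, Finset.sum_const, nsmul_eq_mul]
          congr 2
          have : (Finset.range n).filter (fun j => j < k) = Finset.range k := by
            ext j
            simp only [Finset.mem_filter, Finset.mem_range] at hk ⊢
            omega
          rw [this, Finset.card_range]
      _ = ∑ j ∈ Finset.range n, ∑ k ∈ Finset.range n, if j < k then (P k).toReal else 0 :=
          Finset.sum_comm
      _ ≤ ∑ j ∈ Finset.range n, c * ((j : ℝ) + 1) ^ (-(τ - 1)) := by
          refine Finset.sum_le_sum fun j hj => ?_
          have h1 := h (j + 1) (by omega)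
          push_cast at h1
          refine le_trans ?_ h1
          have hs' : Summable fun i => (P (j + 1 + i)).toReal :=
            hs.comp_injective (add_right_injective (j + 1))
          rw [← Finset.sum_filter]
          have : (Finset.range n).filter (fun k => j < k) =
              (Finset.range (n - (j + 1))).image (fun i => j + 1 + i) := by
            ext k
            simp only [Finset.mem_filter, Finset.mem_range, Finset.mem_image]
            constructor
            · intro hk
              exact ⟨k - (j + 1), by omega, by omega⟩
            · rintro ⟨i, hi, rfl⟩
              omega
          rw [this, Finset.sum_image (by intro a _ b _ hab; simpa using hab)]
          exact hs'.sum_le_tsum _ fun _ _ => ENNReal.toReal_nonneg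
      _ ≤ _ := hpow.sum_le_tsum _ fun j _ => by positivity
  exact summable_of_sum_range_le (fun k => by positivity) htail

theorem isProbabilityMeasure_sizeBiased {P : PMF ℕ}
    (hs : Summable fun k : ℕ => (k : ℝ) * (P k).toReal) (h0 : P 0 ≠ 1) :
    IsProbabilityMeasure (sizeBiased P) := by
  have hnn : ∀ k : ℕ, 0 ≤ (k : ℝ) * (P k).toReal := fun k => by positivity
  have hpos : 0 < degMean P := by
    by_contra hle
    have hz : degMean P = 0 := le_antisymm (not_lt.1 hle) (tsum_nonneg hnn)
    have hsum : HasSum (fun k : ℕ => (k : ℝ) * (P k).toReal) (degMean P) := hs.hasSum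
    rw [hz] at hsum
    have hall := (hasSum_zero_iff_of_nonneg hnn).1 hsum
    apply h0
    rw [P.apply_eq_one_iff]
    apply Set.Subset.antisymm
    · intro k hk
      have hk1 := congrFun hall k
      have hk2 : (P k).toReal ≠ 0 := ENNReal.toReal_ne_zero.2
        ⟨(P.mem_support_iff k).1 hk, P.apply_ne_top k⟩
      simpa [hk2] using hk1
    · rintro k rfl
      rw [P.mem_support_iff]
      intro hk
      have : ∀ k, P k = 0 := by
        intro k
        rcases Nat.eq_zero_or_pos k with rfl | hk'
        · exact hk
        · have hk1 := congrFun hall k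
          have : (k : ℝ) ≠ 0 := by positivity
          have := (mul_eq_zero.1 hk1).resolve_left this
          exact ((ENNReal.toReal_eq_zero_iff _).1 this).resolve_right (P.apply_ne_top k)
      have h1 := P.tsum_coe
      simp [this] at h1
  have hsum : HasSum (sizeBiasedWeight P) 1 := by
    have h1 : HasSum (fun k : ℕ => ((k + 1 : ℕ) : ℝ) * (P (k + 1)).toReal) (degMean P) := by
      have := (hasSum_nat_add_iff' (f := fun k : ℕ => (k : ℝ) * (P k).toReal) 1).2 hs.hasSum
      simpa [degMean] using this
    have h2 := h1.div_const (degMean P)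
    rw [div_self hpos.ne'] at h2
    have h3 : sizeBiasedWeight P =
        fun k : ℕ => ((k + 1 : ℕ) : ℝ) * (P (k + 1)).toReal / degMean P := by
      funext k
      simp [sizeBiasedWeight]
    rw [h3]
    exact h2
  constructor
  have hw : ∀ k, 0 ≤ sizeBiasedWeight P k := fun k => by
    unfold sizeBiasedWeight; positivity
  rw [sizeBiased, Measure.sum_apply _ MeasurableSet.univ]
  simp only [Measure.smul_apply, measure_univ, smul_eq_mul, mul_one]
  rw [← ENNReal.ofReal_tsum_of_nonneg hw hsum.summable, hsum.tsum_eq, ENNReal.ofReal_one]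

theorem continuous_tanh' : Continuous Real.tanh := by
  simp only [funext Real.tanh_eq_sinh_div_cosh]
  exact Real.continuous_sinh.div Real.continuous_cosh fun x => (Real.cosh_pos x).ne'

theorem measurable_treeStep (β B : ℝ) : Measurable (treeStep β B) := by
  apply measurable_from_prod_countable_right
  intro k
  have := continuous_tanh'.measurable
  simp only [treeStep, Real.artanh]
  fun_prop

theorem measurable_vertexTerm (β B : ℝ) : Measurable (vertexTerm β B) := by
  apply measurable_from_prod_countable_right
  intro k
  have := continuous_tanh'.measurable
  simp only [vertexTerm]
  fun_prop

theorem measurable_edgeTerm (β : ℝ) : Measurable (edgeTerm β) := by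
  have := continuous_tanh'.measurable
  unfold edgeTerm
  fun_prop

theorem tanh_nonneg' {x : ℝ} (hx : 0 ≤ x) : 0 ≤ Real.tanh x := by
  rw [Real.tanh_eq_sinh_div_cosh]
  exact div_nonneg (Real.sinh_nonneg_iff.2 hx) (Real.cosh_pos x).le

theorem integrable_edgeTerm {β : ℝ} (hβ : 0 ≤ β) {ν : Measure ℝ} [IsProbabilityMeasure ν]
    (hν : ∀ᵐ h ∂ν, 0 ≤ h) : Integrable (edgeTerm β) (ν.prod ν) := by
  refine Integrable.of_bound (measurable_edgeTerm β).aestronglyMeasurable (Real.log 2) ?_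
  have h1 : ∀ᵐ h ∂(ν.prod ν), 0 ≤ h.1 := Measure.quasiMeasurePreserving_fst.ae hν
  have h2 : ∀ᵐ h ∂(ν.prod ν), 0 ≤ h.2 := Measure.quasiMeasurePreserving_snd.ae hν
  filter_upwards [h1, h2] with h h1 h2
  have a := tanh_nonneg' hβ
  have b := tanh_nonneg' h1
  have c := tanh_nonneg' h2
  have d : Real.tanh β * Real.tanh h.1 * Real.tanh h.2 ≤ 1 :=
    mul_le_one₀ (mul_le_one₀ (Real.tanh_lt_one _).le b (Real.tanh_lt_one _).le) c
      (Real.tanh_lt_one _).le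
  have e : 0 ≤ Real.tanh β * Real.tanh h.1 * Real.tanh h.2 := by positivity
  unfold edgeTerm
  rw [Real.norm_of_nonneg (Real.log_nonneg (by linarith))]
  exact Real.log_le_log (by linarith) (by linarith)

theorem integrable_vertexTerm {P : PMF ℕ} (hs : Summable fun k : ℕ => (k : ℝ) * (P k).toReal)
    {β B : ℝ} (hβ : 0 ≤ β) (hB : 0 ≤ B) {ν : Measure ℝ} [IsProbabilityMeasure ν]
    (hν : ∀ᵐ h ∂ν, 0 ≤ h) : Integrable (vertexTerm β B) (P.toMeasure.prod (iidLaw ν)) := by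
  have : IsProbabilityMeasure (iidLaw ν) := by unfold iidLaw; infer_instance
  have hL : Integrable (fun k : ℕ => (k : ℝ) * Real.log 2 + (Real.log 2 + B)) P.toMeasure := by
    refine (Integrable.mul_const ?_ _).add (integrable_const _)
    rw [← Measure.sum_smul_dirac (P.toMeasure)]
    refine integrable_sum_dirac (fun k => measure_ne_top _ _) ?_
    refine hs.congr fun k => ?_
    rw [P.toMeasure_apply_singleton k (MeasurableSet.singleton k),
      Real.norm_of_nonneg (Nat.cast_nonneg k), mul_comm]
  refine (hL.comp_fst (iidLaw ν)).mono' (measurable_vertexTerm β B).aestronglyMeasurable ?_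
  have h1 : ∀ᵐ h ∂(iidLaw ν), ∀ i, 0 ≤ h i := by
    rw [ae_all_iff]
    intro i
    exact (measurePreserving_eval_infinitePi (fun _ : ℕ => ν) i).quasiMeasurePreserving.ae hν
  have h2 : ∀ᵐ x ∂(P.toMeasure.prod (iidLaw ν)), ∀ i, 0 ≤ x.2 i :=
    Measure.quasiMeasurePreserving_snd.ae h1
  filter_upwards [h2] with x hx
  have a := tanh_nonneg' hβ
  have a1 := (Real.tanh_lt_one β).le
  have b : ∀ i, 0 ≤ Real.tanh β * Real.tanh (x.2 i) := fun i => mul_nonneg a (tanh_nonneg' (hx i))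
  have c : ∀ i, Real.tanh β * Real.tanh (x.2 i) ≤ 1 := fun i =>
    mul_le_one₀ a1 (tanh_nonneg' (hx i)) (Real.tanh_lt_one _).le
  have p1 : 1 ≤ ∏ i ∈ Finset.range x.1, (1 + Real.tanh β * Real.tanh (x.2 i)) :=
    Finset.one_le_prod fun i _ => by linarith [b i]
  have p2 : ∏ i ∈ Finset.range x.1, (1 + Real.tanh β * Real.tanh (x.2 i)) ≤ 2 ^ x.1 := by
    refine (Finset.prod_le_prod (fun i _ => by linarith [b i])
      (fun i _ => show _ ≤ (2 : ℝ) by linarith [c i])).trans ?_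
    simp
  have q1 : 0 ≤ ∏ i ∈ Finset.range x.1, (1 - Real.tanh β * Real.tanh (x.2 i)) :=
    Finset.prod_nonneg fun i _ => by linarith [c i]
  have q2 : ∏ i ∈ Finset.range x.1, (1 - Real.tanh β * Real.tanh (x.2 i)) ≤ 1 :=
    Finset.prod_le_one (fun i _ => by linarith [c i]) fun i _ => by linarith [b i]
  have eB : 1 ≤ Real.exp B := Real.one_le_exp hB
  have eB' : Real.exp (-B) ≤ 1 := Real.exp_le_one_iff.2 (by linarith)
  have e0 := (Real.exp_pos (-B)).le
  have t : (1 : ℝ) ≤ 2 ^ x.1 := one_le_pow₀ (by norm_num)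
  have lo : 1 ≤ Real.exp B * ∏ i ∈ Finset.range x.1, (1 + Real.tanh β * Real.tanh (x.2 i)) +
      Real.exp (-B) * ∏ i ∈ Finset.range x.1, (1 - Real.tanh β * Real.tanh (x.2 i)) := by
    have := mul_nonneg e0 q1
    nlinarith
  have hi : Real.exp B * ∏ i ∈ Finset.range x.1, (1 + Real.tanh β * Real.tanh (x.2 i)) +
      Real.exp (-B) * ∏ i ∈ Finset.range x.1, (1 - Real.tanh β * Real.tanh (x.2 i)) ≤
      2 ^ x.1 * (2 * Real.exp B) := by
    have u := mul_le_mul_of_nonneg_left p2 (Real.exp_pos B).le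
    have v := mul_le_one₀ eB' q1 q2
    nlinarith
  unfold vertexTerm
  rw [Real.norm_of_nonneg (Real.log_nonneg lo)]
  refine (Real.log_le_log (by linarith) hi).trans (le_of_eq ?_)
  rw [Real.log_mul (by positivity) (by positivity), Real.log_mul (by norm_num) (by positivity),
    Real.log_pow, Real.log_exp]

end RandomIsing

end

noncomputable section

namespace RandomIsing

/-! Two facts combine: the pressure is stationary in the law of `h` at a fixed point, and fixed
points at nearby parameters can be coupled uniformly closely.

Stationarity. Couple the two fixed points so that `|tanh h₂ - tanh h₁| ≤ δ` almost surely, and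
expand to first order in the change of law. An edge has two ends, so its expectation changes by
`2G`, where `G` is the mean effect of moving one field against an independent field of law `ν₁`; the
prefactor `degMean P / 2` turns this into `degMean P * G`. At a vertex, moving one incoming message
acts against the cavity field built from `B` and the other messages. Summing over the neighbours
size-biases the degree, so the cavity field is one step of the recursion and again has law `ν₁`: the
vertex expectation also changes by `degMean P * G` (`integral_vertexGrad`), and the two cancel.
There remain an edge error of order `δ ^ 2` and a vertex error of order `min (kδ) ((kδ)²)` at degree
`k` (`abs_vertex_remainder_le`), whose mean is `O(δ ^ (τ - 1))` by the tail bound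
(`StronglyFiniteMean.exists_tsum_min_le`).

Coupling. The message `artanh (tanh β tanh h)` is concave in `h ≥ 0` and vanishes at `0`; hence on
fields bounded away from `0` it contracts logarithmic ratios by a factor `1 - c`
(`exists_message_contraction`). Fixed points live on `[B, ∞)`. Running both recursions on the same
tree therefore sends an almost sure log-ratio bound `r` to `s + (1 - c)(r - s)`, where `s` is the
price of the parameter change, and iteration brings `r` as close to `s` as desired
(`exists_coupling_ratio`). Since `tanh` is 1-Lipschitz in the logarithm of its positive argument,
`δ` can be taken arbitrarily close to `s`, which is proportional to `|β₁ - β₂|` or `|B₁ - B₂|`.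

Uniformity for large `β` holds because the `β`-derivative of the message is dominated by its
concavity defect, with a constant depending only on the lower bounds (`message_deriv_le`). The rate
`c` does depend on `β`, but only affects how many iterations are needed. Uniqueness of the fixed
point is never needed. -/

theorem tanh_strictMono : StrictMono Real.tanh := fun x y hxy => by
  have hx : Real.tanh x ∈ Set.Ioo (-1 : ℝ) 1 := ⟨Real.neg_one_lt_tanh x, Real.tanh_lt_one x⟩
  have hy : Real.tanh y ∈ Set.Ioo (-1 : ℝ) 1 := ⟨Real.neg_one_lt_tanh y, Real.tanh_lt_one y⟩
  rw [← Real.strictMonoOn_artanh.lt_iff_lt hx hy, Real.artanh_tanh, Real.artanh_tanh]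
  exact hxy

theorem tanh_add (x y : ℝ) :
    Real.tanh (x + y) = (Real.tanh x + Real.tanh y) / (1 + Real.tanh x * Real.tanh y) := by
  have hx := Real.cosh_pos x
  have hy := Real.cosh_pos y
  have hxy := Real.cosh_pos (x + y)
  have h1 : 1 + Real.tanh x * Real.tanh y = Real.cosh (x + y) / (Real.cosh x * Real.cosh y) := by
    rw [Real.cosh_add, Real.tanh_eq_sinh_div_cosh, Real.tanh_eq_sinh_div_cosh]
    field_simp
  rw [h1, Real.tanh_eq_sinh_div_cosh (x + y), Real.sinh_add, Real.tanh_eq_sinh_div_cosh x,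
    Real.tanh_eq_sinh_div_cosh y]
  field_simp

theorem le_of_hasDerivAt_nonpos {f f' : ℝ → ℝ} {a x : ℝ} (hax : a ≤ x)
    (hf : ∀ s, a ≤ s → HasDerivAt f (f' s) s) (hf' : ∀ s, a ≤ s → f' s ≤ 0) : f x ≤ f a := by
  have h : AntitoneOn f (Set.Ici a) := by
    refine antitoneOn_of_deriv_nonpos (convex_Ici a)
      (fun s hs => (hf s hs).continuousAt.continuousWithinAt)
      (fun s hs => ?_) (fun s hs => ?_)
    · exact (hf s (interior_subset hs)).differentiableAt.differentiableWithinAt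
    · rw [(hf s (interior_subset hs)).deriv]
      exact hf' s (interior_subset hs)
  exact h (Set.self_mem_Ici) hax hax

/-! ### The message function and its derivatives -/

/-- The message sent along an edge of strength `β` by a vertex with field `h`. -/
def message (β h : ℝ) : ℝ := Real.artanh (Real.tanh β * Real.tanh h)

/-- The factors `1 ± tanh β tanh h` equal `cosh (β ± h) / (cosh β cosh h)`. In this form both
partial derivatives are half-sums and half-differences of `tanh`. -/
theorem message_eq (β h : ℝ) :
    message β h = (Real.log (Real.cosh (β + h)) - Real.log (Real.cosh (β - h))) / 2 := by
  have hb := Real.cosh_pos β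
  have hh := Real.cosh_pos h
  have hm : Real.tanh β * Real.tanh h ∈ Set.Icc (-1 : ℝ) 1 := by
    have h1 := (Real.abs_tanh_lt_one β).le
    have h2 := (Real.abs_tanh_lt_one h).le
    rw [Set.mem_Icc, ← abs_le, abs_mul]
    exact mul_le_one₀ h1 (abs_nonneg _) h2
  rw [message, Real.artanh_eq_half_log hm,
    ← Real.log_div (Real.cosh_pos _).ne' (Real.cosh_pos _).ne']
  have e1 : 1 + Real.tanh β * Real.tanh h =
      Real.cosh (β + h) / (Real.cosh β * Real.cosh h) := by
    rw [Real.cosh_add, Real.tanh_eq_sinh_div_cosh, Real.tanh_eq_sinh_div_cosh]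
    field_simp
  have e2 : 1 - Real.tanh β * Real.tanh h =
      Real.cosh (β - h) / (Real.cosh β * Real.cosh h) := by
    rw [Real.cosh_sub, Real.tanh_eq_sinh_div_cosh, Real.tanh_eq_sinh_div_cosh]
    field_simp
  rw [e1, e2, div_div_div_cancel_right₀ (by positivity)]
  ring

theorem message_comm (β h : ℝ) : message β h = message h β := by
  rw [message, message, mul_comm]

theorem tanh_message {β h : ℝ} : Real.tanh (message β h) = Real.tanh β * Real.tanh h := by
  have h1 := Real.abs_tanh_lt_one β
  have h2 := Real.abs_tanh_lt_one h
  refine Real.tanh_artanh ?_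
  rw [Set.mem_Ioo, ← abs_lt, abs_mul]
  exact mul_lt_one_of_nonneg_of_lt_one_left (abs_nonneg _) h1 h2.le

theorem message_nonneg {β h : ℝ} (hβ : 0 ≤ β) (hh : 0 ≤ h) : 0 ≤ message β h :=
  Real.artanh_nonneg (mul_nonneg (tanh_nonneg' hβ) (tanh_nonneg' hh))

theorem message_mono {β h h' : ℝ} (hβ : 0 ≤ β) (hh : h ≤ h') : message β h ≤ message β h' := by
  rw [← tanh_strictMono.le_iff_le, tanh_message, tanh_message]
  exact mul_le_mul_of_nonneg_left (tanh_strictMono.monotone hh) (tanh_nonneg' hβ)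

theorem message_mono_left {β β' h : ℝ} (hh : 0 ≤ h) (hβ : β ≤ β') :
    message β h ≤ message β' h := by
  rw [message_comm β, message_comm β']
  exact message_mono hh hβ

theorem message_pos {β h : ℝ} (hβ : 0 < β) (hh : 0 < h) : 0 < message β h := by
  have h1 : 0 < Real.tanh β := by simpa using tanh_strictMono hβ
  have h2 : 0 < Real.tanh h := by simpa using tanh_strictMono hh
  rw [← tanh_strictMono.lt_iff_lt, tanh_message, Real.tanh_zero]
  positivity

theorem message_le_left {β h : ℝ} (hβ : 0 ≤ β) : message β h ≤ β := by
  rw [← tanh_strictMono.le_iff_le, tanh_message]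
  exact mul_le_of_le_one_right (tanh_nonneg' hβ) (Real.tanh_lt_one h).le

theorem hasDerivAt_log_cosh (x : ℝ) :
    HasDerivAt (fun x => Real.log (Real.cosh x)) (Real.tanh x) x := by
  rw [Real.tanh_eq_sinh_div_cosh]
  exact (Real.hasDerivAt_cosh x).log (Real.cosh_pos x).ne'

theorem hasDerivAt_message {p q : ℝ → ℝ} {p' q' s : ℝ} (hp : HasDerivAt p p' s)
    (hq : HasDerivAt q q' s) :
    HasDerivAt (fun s => message (p s) (q s))
      ((Real.tanh (p s + q s) - Real.tanh (p s - q s)) / 2 * p' +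
        (Real.tanh (p s + q s) + Real.tanh (p s - q s)) / 2 * q') s := by
  simp only [message_eq]
  have h1 := (hasDerivAt_log_cosh _).comp s (hp.add hq)
  have h2 := (hasDerivAt_log_cosh _).comp s (hp.sub hq)
  refine ((h1.sub h2).div_const 2).congr_deriv ?_
  simp only [Pi.add_apply, Pi.sub_apply]
  ring

theorem cosh_two_mul_add_cosh_two_mul (β h : ℝ) :
    Real.cosh (2 * β) + Real.cosh (2 * h) = 2 * (Real.cosh (β + h) * Real.cosh (β - h)) := by
  rw [show 2 * β = (β + h) + (β - h) by ring, show 2 * h = (β + h) - (β - h) by ring,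
    Real.cosh_add (β + h) (β - h), Real.cosh_sub (β + h) (β - h)]
  ring

theorem tanh_add_tanh_mul (β h : ℝ) :
    (Real.tanh (β + h) + Real.tanh (β - h)) / 2 * (Real.cosh (2 * β) + Real.cosh (2 * h)) =
      Real.sinh (2 * β) := by
  have h1 := Real.cosh_pos (β + h)
  have h2 := Real.cosh_pos (β - h)
  rw [cosh_two_mul_add_cosh_two_mul, show 2 * β = (β + h) + (β - h) by ring, Real.sinh_add,
    Real.tanh_eq_sinh_div_cosh, Real.tanh_eq_sinh_div_cosh]
  field_simp

theorem tanh_sub_tanh_mul (β h : ℝ) :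
    (Real.tanh (β + h) - Real.tanh (β - h)) / 2 * (Real.cosh (2 * β) + Real.cosh (2 * h)) =
      Real.sinh (2 * h) := by
  have h1 := Real.cosh_pos (β + h)
  have h2 := Real.cosh_pos (β - h)
  rw [cosh_two_mul_add_cosh_two_mul, show 2 * h = (β + h) - (β - h) by ring, Real.sinh_sub,
    Real.tanh_eq_sinh_div_cosh, Real.tanh_eq_sinh_div_cosh]
  field_simp

/-! ### Concavity defect of the message and rescaling inequalities -/

/-- The concavity defect `message - h ∂_h message`, cleared of the denominator `cosh 2β + cosh 2h`,
has a derivative in which only the message itself survives. -/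
theorem hasDerivAt_message_defect (β h : ℝ) :
    HasDerivAt (fun h => message β h * (Real.cosh (2 * β) + Real.cosh (2 * h)) -
      h * Real.sinh (2 * β)) (2 * message β h * Real.sinh (2 * h)) h := by
  have h1 := hasDerivAt_message (hasDerivAt_const h β) (hasDerivAt_id h)
  have h2 : HasDerivAt (fun h => Real.cosh (2 * β) + Real.cosh (2 * h))
      (Real.sinh (2 * h) * 2) h := by
    have := ((Real.hasDerivAt_cosh (2 * h)).comp h ((hasDerivAt_id h).const_mul 2)).const_add
      (Real.cosh (2 * β))
    simpa using this
  refine ((h1.mul h2).sub ((hasDerivAt_id h).mul_const (Real.sinh (2 * β)))).congr_deriv ?_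
  have := tanh_add_tanh_mul β h
  simp only [id] at *
  linear_combination this

/-- The constant comparing the `β`-derivative of the message with its concavity defect in `h`. -/
def messageConst (b m : ℝ) : ℝ :=
  Real.cosh (2 * m) / (Real.cosh (2 * m) - Real.cosh m) / message b (m / 2)

theorem cosh_lt_cosh_two_mul {m : ℝ} (hm : 0 < m) : Real.cosh m < Real.cosh (2 * m) := by
  rw [Real.cosh_lt_cosh, abs_of_pos hm, abs_of_pos (by linarith)]
  linarith

theorem messageConst_pos {b m : ℝ} (hb : 0 < b) (hm : 0 < m) : 0 < messageConst b m := by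
  have h1 := cosh_lt_cosh_two_mul hm
  have h2 := message_pos hb (half_pos hm)
  have h3 := Real.cosh_pos (2 * m)
  unfold messageConst
  have : 0 < Real.cosh (2 * m) - Real.cosh m := by linarith
  positivity

/-- The cleared defect `N` vanishes at `0` and is nondecreasing, so `N (m / 2) ≥ 0`. Beyond `m / 2`
the message is at least `g = message b (m / 2)`, so integrating `N'` gives `N h ≥ g (cosh 2h - cosh
m)`. For `h ≥ m` this dominates `cosh 2h`, uniformly in `β ≥ b`. -/
theorem sinh_le_messageConst_mul {b m β h : ℝ} (hb : 0 < b) (hm : 0 < m) (hβ : b ≤ β)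
    (hh : m ≤ h) : Real.sinh (2 * h) ≤ messageConst b m *
      (message β h * (Real.cosh (2 * β) + Real.cosh (2 * h)) - h * Real.sinh (2 * β)) := by
  set g := message b (m / 2) with hg
  have hg0 : 0 < g := message_pos hb (half_pos hm)
  set N : ℝ → ℝ := fun h => message β h * (Real.cosh (2 * β) + Real.cosh (2 * h)) -
    h * Real.sinh (2 * β) with hN
  have hβ0 : 0 ≤ β := hb.le.trans hβ
  have d1 : ∀ s, HasDerivAt (fun h => g * Real.cosh (2 * h)) (g * (Real.sinh (2 * s) * 2)) s := by
    intro s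
    have := ((Real.hasDerivAt_cosh (2 * s)).comp s ((hasDerivAt_id s).const_mul 2)).const_mul g
    simpa using this
  have hN0 : 0 ≤ N (m / 2) := by
    have h0 : N 0 = 0 := by simp [hN, message]
    have := le_of_hasDerivAt_nonpos (f := fun h => - N h) (a := 0) (x := m / 2) (by positivity)
      (fun s _ => (hasDerivAt_message_defect β s).neg) (fun s hs => by
        have := message_nonneg hβ0 hs
        have : 0 ≤ Real.sinh (2 * s) := Real.sinh_nonneg_iff.2 (by linarith)
        have : 0 ≤ 2 * message β s * Real.sinh (2 * s) := by positivity
        linarith)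
    simp only [h0] at this
    linarith
  have hN1 : g * Real.cosh (2 * h) - N h ≤ g * Real.cosh (2 * (m / 2)) - N (m / 2) :=
    le_of_hasDerivAt_nonpos (f := fun h => g * Real.cosh (2 * h) - N h) (a := m / 2) (x := h)
      (by linarith) (fun s _ => (d1 s).sub (hasDerivAt_message_defect β s)) (fun s hs => by
        have h1 : g ≤ message β s :=
          (message_mono hb.le hs).trans (message_mono_left (by linarith) hβ)
        have h2 : 0 ≤ Real.sinh (2 * s) := Real.sinh_nonneg_iff.2 (by linarith)
        nlinarith)
  have hcm := cosh_lt_cosh_two_mul hm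
  have hch : Real.cosh (2 * m) ≤ Real.cosh (2 * h) := by
    rw [Real.cosh_le_cosh, abs_of_pos (by linarith), abs_of_pos (by linarith)]
    linarith
  have hm0 := Real.cosh_pos m
  have hNh : g * (Real.cosh (2 * h) - Real.cosh m) ≤ N h := by
    rw [show 2 * (m / 2) = m by ring] at hN1
    linarith
  have hpos : 0 < Real.cosh (2 * m) - Real.cosh m := by linarith
  calc Real.sinh (2 * h) ≤ Real.cosh (2 * h) := (Real.sinh_lt_cosh _).le
    _ ≤ Real.cosh (2 * m) / (Real.cosh (2 * m) - Real.cosh m) *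
        (Real.cosh (2 * h) - Real.cosh m) := by
      rw [div_mul_eq_mul_div, le_div_iff₀ hpos]
      nlinarith
    _ = messageConst b m * (g * (Real.cosh (2 * h) - Real.cosh m)) := by
      rw [messageConst, ← hg]
      field_simp
    _ ≤ _ := mul_le_mul_of_nonneg_left hNh (messageConst_pos hb hm).le

theorem message_deriv_le {b m β h : ℝ} (hb : 0 < b) (hm : 0 < m) (hβ : b ≤ β) (hh : m ≤ h) :
    (Real.tanh (β + h) - Real.tanh (β - h)) / 2 ≤ messageConst b m *
      (message β h - (Real.tanh (β + h) + Real.tanh (β - h)) / 2 * h) := by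
  have h1 := sinh_le_messageConst_mul hb hm hβ hh
  have hW : 0 < Real.cosh (2 * β) + Real.cosh (2 * h) :=
    add_pos (Real.cosh_pos _) (Real.cosh_pos _)
  refine le_of_mul_le_mul_right ?_ hW
  rw [tanh_sub_tanh_mul]
  refine h1.trans (le_of_eq ?_)
  linear_combination messageConst b m * h * (tanh_add_tanh_mul β h)

theorem hasDerivAt_exp_mul_const (y s : ℝ) :
    HasDerivAt (fun s => Real.exp s * y) (Real.exp s * y) s :=
  (Real.hasDerivAt_exp s).mul_const y

/-- Along the curve `(β + t / C, e^t y)` the quantity `e^{-t} message` is nonincreasing: the growth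
from `β` is paid for by the concavity defect in the field. -/
theorem message_le_exp_mul_of_beta {b m β y s : ℝ} (hb : 0 < b) (hm : 0 < m) (hβ : b ≤ β)
    (hy : m ≤ y) (hs : 0 ≤ s) :
    message (β + s / messageConst b m) (Real.exp s * y) ≤ Real.exp s * message β y := by
  set C := messageConst b m with hC
  have hC0 : 0 < C := messageConst_pos hb hm
  have hd : ∀ s, HasDerivAt (fun s => β + s / C) (1 / C) s := fun s =>
    ((hasDerivAt_id s).div_const C).const_add β
  have hE : ∀ s, HasDerivAt (fun s => Real.exp (-s)) (-Real.exp (-s)) s := fun s => by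
    simpa [Function.comp_def] using (Real.hasDerivAt_exp (-s)).comp s (hasDerivAt_neg s)
  have key := le_of_hasDerivAt_nonpos hs
    (fun t _ => (hE t).mul (hasDerivAt_message (hd t) (hasDerivAt_exp_mul_const y t)))
    (fun t ht => by
      have h1 : b ≤ β + t / C := by
        have : 0 ≤ t / C := by positivity
        linarith
      have h2 : m ≤ Real.exp t * y := by
        have := Real.one_le_exp ht
        nlinarith
      have h3 := message_deriv_le hb hm h1 h2
      rw [← hC] at h3
      have h4 := Real.exp_pos (-t)
      set A := (Real.tanh (β + t / C + Real.exp t * y) - Real.tanh (β + t / C - Real.exp t * y)) / 2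
      set D := (Real.tanh (β + t / C + Real.exp t * y) + Real.tanh (β + t / C - Real.exp t * y)) / 2
      have h5 : A * (1 / C) ≤ message (β + t / C) (Real.exp t * y) - D * (Real.exp t * y) := by
        rw [mul_one_div, div_le_iff₀ hC0, mul_comm]
        exact h3
      nlinarith)
  simp only [Pi.mul_apply, neg_zero, Real.exp_zero, one_mul, zero_div, add_zero] at key
  rw [Real.exp_neg, inv_mul_le_iff₀ (Real.exp_pos s)] at key
  exact key

/-- The logarithmic derivative of the message in `log h` is at most `1 - c` once the concavity
defect is at least `c` times the message. The defect is bounded below by `message_deriv_le` and the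
message above by `β`. -/
theorem exists_message_contraction {β m : ℝ} (hβ : 0 < β) (hm : 0 < m) :
    ∃ c : ℝ, 0 < c ∧ c < 1 ∧ ∀ y u : ℝ, m ≤ y → 0 ≤ u →
      message β (Real.exp u * y) ≤ Real.exp ((1 - c) * u) * message β y := by
  set C := messageConst β m
  have hC0 : 0 < C := messageConst_pos hβ hm
  set a := (Real.tanh (β + m) - Real.tanh (β - m)) / 2 with ha
  have ha0 : 0 < a := by
    have := tanh_strictMono (show β - m < β + m by linarith)
    rw [ha]; linarith
  -- On `[m, ∞)` the defect is at least `a / C` and the message at most `β`; the cap `1 / 2` only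
  -- ensures `c < 1`.
  set c := min (a / (C * β)) (1 / 2) with hc
  have hc0 : 0 < c := by rw [hc]; positivity
  refine ⟨c, hc0, (min_le_right _ _).trans_lt (by norm_num), fun y u hy hu => ?_⟩
  have hE : ∀ s, HasDerivAt (fun s => Real.exp (-((1 - c) * s)))
      (-(1 - c) * Real.exp (-((1 - c) * s))) s := fun s => by
    have := (Real.hasDerivAt_exp (-((1 - c) * s))).comp s
      ((hasDerivAt_id s).const_mul (1 - c)).neg
    refine this.congr_deriv ?_
    ring
  have key := le_of_hasDerivAt_nonpos hu
    (fun t _ => (hE t).mul (hasDerivAt_message (hasDerivAt_const t β)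
      (hasDerivAt_exp_mul_const y t)))
    (fun t ht => by
      have h2 : m ≤ Real.exp t * y := by
        have := Real.one_le_exp ht
        nlinarith
      have h3 := message_deriv_le hβ hm le_rfl h2
      have h4 := Real.exp_pos (-((1 - c) * t))
      have h5 := message_le_left (h := Real.exp t * y) hβ.le
      have h6 := message_nonneg (h := Real.exp t * y) hβ.le (by linarith)
      have h7 : a ≤ (Real.tanh (β + Real.exp t * y) - Real.tanh (β - Real.exp t * y)) / 2 := by
        have e1 := tanh_strictMono.monotone (show β + m ≤ β + Real.exp t * y by linarith)
        have e2 := tanh_strictMono.monotone (show β - Real.exp t * y ≤ β - m by linarith)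
        rw [ha]; linarith
      set D := (Real.tanh (β + Real.exp t * y) + Real.tanh (β - Real.exp t * y)) / 2
      have h8 : c * message β (Real.exp t * y) ≤
          message β (Real.exp t * y) - D * (Real.exp t * y) := by
        have e1 : c * message β (Real.exp t * y) ≤ a / (C * β) * β :=
          mul_le_mul (min_le_left _ _) h5 h6 (by positivity)
        have e2 : a / (C * β) * β = a / C := by field_simp
        rw [e2] at e1
        refine e1.trans ?_
        rw [div_le_iff₀ hC0, mul_comm]
        exact h7.trans h3
      nlinarith)
  simp only [Pi.mul_apply, mul_zero, neg_zero, Real.exp_zero, one_mul] at key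
  rw [Real.exp_neg, inv_mul_le_iff₀ (Real.exp_pos _)] at key
  exact key

theorem message_le_exp_mul {β y s : ℝ} (hβ : 0 < β) (hy : 0 < y) (hs : 0 ≤ s) :
    message β (Real.exp s * y) ≤ Real.exp s * message β y := by
  obtain ⟨c, hc0, -, h⟩ := exists_message_contraction hβ hy
  refine (h y s le_rfl hs).trans ?_
  refine mul_le_mul_of_nonneg_right (Real.exp_le_exp.2 ?_) (message_nonneg hβ.le hy.le)
  nlinarith

/-- With `x = e^t y`, the derivative in `t` is `x / cosh² x`, and `x ≤ sinh x ≤ cosh x ≤ cosh² x`.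
This turns ratio bounds into additive bounds on `tanh`. -/
theorem tanh_exp_mul_sub_le {y s : ℝ} (hy : 0 ≤ y) (hs : 0 ≤ s) :
    Real.tanh (Real.exp s * y) - Real.tanh y ≤ s := by
  have hd : ∀ x, HasDerivAt Real.tanh (1 / Real.cosh x ^ 2) x := fun x => by
    have h := (Real.hasDerivAt_sinh x).div (Real.hasDerivAt_cosh x) (Real.cosh_pos x).ne'
    rw [← pow_two, ← pow_two, Real.cosh_sq_sub_sinh_sq] at h
    exact h.congr_of_eventuallyEq (Filter.Eventually.of_forall Real.tanh_eq_sinh_div_cosh)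
  have key := le_of_hasDerivAt_nonpos (f := fun t => Real.tanh (Real.exp t * y) - t) hs
    (fun t _ => ((hd _).comp t (hasDerivAt_exp_mul_const y t)).sub (hasDerivAt_id t))
    (fun t _ => by
      set x := Real.exp t * y
      have hx : 0 ≤ x := by positivity
      have h1 : x ≤ Real.sinh x := Real.self_le_sinh_iff.2 hx
      have h2 := (Real.sinh_lt_cosh x).le
      have h3 := Real.one_le_cosh x
      rw [one_div_mul_eq_div, sub_nonpos, div_le_one (by positivity)]
      nlinarith)
  simp only [Real.exp_zero, one_mul, sub_zero] at key
  linarith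

/-! ### Couplings of tree fixed points -/

theorem treeStep_eq (β B : ℝ) (x : ℕ × (ℕ → ℝ)) :
    treeStep β B x = B + ∑ i ∈ Finset.range x.1, message β (x.2 i) := rfl

instance sFinite_sizeBiased (P : PMF ℕ) : SFinite (sizeBiased P) := by
  unfold sizeBiased
  infer_instance

theorem ae_forall_infinitePi {α : Type*} [MeasurableSpace α] {π : Measure α}
    [IsProbabilityMeasure π] {p : α → Prop} (h : ∀ᵐ a ∂π, p a) :
    ∀ᵐ ω ∂(Measure.infinitePi fun _ : ℕ => π), ∀ i, p (ω i) := by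
  rw [ae_all_iff]
  intro i
  exact (measurePreserving_eval_infinitePi (fun _ : ℕ => π) i).quasiMeasurePreserving.ae h

/-- One step of the recursion adds nonnegative messages to `B`. This keeps the fields away from `0`,
where the contraction degenerates. -/
theorem IsTreeFixedPoint.ae_le {P : PMF ℕ} {β B : ℝ} {ν : Measure ℝ} (hβ : 0 ≤ β)
    (h : IsTreeFixedPoint P β B ν) : ∀ᵐ x ∂ν, B ≤ x := by
  have := h.isProbabilityMeasure
  have : IsProbabilityMeasure (iidLaw ν) := by unfold iidLaw; infer_instance
  rw [← h.fixed, treeRecursion, ae_map_iff (measurable_treeStep β B).aemeasurable measurableSet_Ici]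
  have h2 : ∀ᵐ x ∂((sizeBiased P).prod (iidLaw ν)), ∀ i, 0 ≤ x.2 i :=
    Measure.quasiMeasurePreserving_snd.ae (ae_forall_infinitePi h.nonneg)
  filter_upwards [h2] with x hx
  rw [treeStep_eq, le_add_iff_nonneg_right]
  exact Finset.sum_nonneg fun i _ => message_nonneg hβ (hx i)

/-- A coupling of `ν₁` and `ν₂` on `ℝ × ℝ`. -/
structure IsCoupling (π : Measure (ℝ × ℝ)) (ν₁ ν₂ : Measure ℝ) : Prop where
  isProbabilityMeasure : IsProbabilityMeasure π
  map_fst : π.map Prod.fst = ν₁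
  map_snd : π.map Prod.snd = ν₂

theorem isCoupling_prod (ν₁ ν₂ : Measure ℝ) [IsProbabilityMeasure ν₁] [IsProbabilityMeasure ν₂] :
    IsCoupling (ν₁.prod ν₂) ν₁ ν₂ :=
  ⟨inferInstance, by simp [Measure.map_fst_prod], by simp [Measure.map_snd_prod]⟩

theorem IsCoupling.ae_fst {π : Measure (ℝ × ℝ)} {ν₁ ν₂ : Measure ℝ} (h : IsCoupling π ν₁ ν₂)
    {p : ℝ → Prop} (hp : ∀ᵐ x ∂ν₁, p x) : ∀ᵐ x ∂π, p x.1 := by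
  rw [← h.map_fst] at hp
  exact ae_of_ae_map measurable_fst.aemeasurable hp

theorem IsCoupling.ae_snd {π : Measure (ℝ × ℝ)} {ν₁ ν₂ : Measure ℝ} (h : IsCoupling π ν₁ ν₂)
    {p : ℝ → Prop} (hp : ∀ᵐ x ∂ν₂, p x) : ∀ᵐ x ∂π, p x.2 := by
  rw [← h.map_snd] at hp
  exact ae_of_ae_map measurable_snd.aemeasurable hp

theorem IsCoupling.infinitePi_map_fst {π : Measure (ℝ × ℝ)} {ν₁ ν₂ : Measure ℝ}
    (h : IsCoupling π ν₁ ν₂) :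
    (Measure.infinitePi fun _ : ℕ => π).map (fun ω i => (ω i).1) = iidLaw ν₁ := by
  have := h.isProbabilityMeasure
  rw [Measure.infinitePi_map_pi (f := fun _ => Prod.fst) _ (fun _ => measurable_fst), h.map_fst,
    iidLaw]

theorem IsCoupling.infinitePi_map_snd {π : Measure (ℝ × ℝ)} {ν₁ ν₂ : Measure ℝ}
    (h : IsCoupling π ν₁ ν₂) :
    (Measure.infinitePi fun _ : ℕ => π).map (fun ω i => (ω i).2) = iidLaw ν₂ := by
  have := h.isProbabilityMeasure
  rw [Measure.infinitePi_map_pi (f := fun _ => Prod.snd) _ (fun _ => measurable_snd), h.map_snd,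
    iidLaw]

theorem IsCoupling.prod_map_fst {π : Measure (ℝ × ℝ)} {ν₁ ν₂ : Measure ℝ}
    (h : IsCoupling π ν₁ ν₂) (ρ : Measure ℕ) [SFinite ρ] :
    (ρ.prod (Measure.infinitePi fun _ : ℕ => π)).map
      (fun x => (x.1, fun i => (x.2 i).1)) = ρ.prod (iidLaw ν₁) := by
  have := h.isProbabilityMeasure
  rw [← h.infinitePi_map_fst]
  conv_rhs => rw [← Measure.map_id (μ := ρ)]
  rw [Measure.map_prod_map _ _ measurable_id (by fun_prop)]
  rfl

theorem IsCoupling.prod_map_snd {π : Measure (ℝ × ℝ)} {ν₁ ν₂ : Measure ℝ}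
    (h : IsCoupling π ν₁ ν₂) (ρ : Measure ℕ) [SFinite ρ] :
    (ρ.prod (Measure.infinitePi fun _ : ℕ => π)).map
      (fun x => (x.1, fun i => (x.2 i).2)) = ρ.prod (iidLaw ν₂) := by
  have := h.isProbabilityMeasure
  rw [← h.infinitePi_map_snd]
  conv_rhs => rw [← Measure.map_id (μ := ρ)]
  rw [Measure.map_prod_map _ _ measurable_id (by fun_prop)]
  rfl

/-- The recursions at `(β₁, B₁)` and `(β₂, B₂)` run on the same tree. -/
def pairStep (β₁ B₁ β₂ B₂ : ℝ) (x : ℕ × (ℕ → ℝ × ℝ)) : ℝ × ℝ :=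
  (treeStep β₁ B₁ (x.1, fun i => (x.2 i).1), treeStep β₂ B₂ (x.1, fun i => (x.2 i).2))

theorem measurable_pairStep (β₁ B₁ β₂ B₂ : ℝ) : Measurable (pairStep β₁ B₁ β₂ B₂) := by
  have h1 := measurable_treeStep β₁ B₁
  have h2 := measurable_treeStep β₂ B₂
  unfold pairStep
  fun_prop

/-- Each marginal evolves by its own recursion and is invariant, so sharing the degree and using
coupled inputs yields a coupling of the same two laws. -/
theorem IsCoupling.step {P : PMF ℕ} {β₁ B₁ β₂ B₂ : ℝ} {ν₁ ν₂ : Measure ℝ}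
    {π : Measure (ℝ × ℝ)} (h₁ : IsTreeFixedPoint P β₁ B₁ ν₁) (h₂ : IsTreeFixedPoint P β₂ B₂ ν₂)
    (h : IsCoupling π ν₁ ν₂) :
    IsCoupling (((sizeBiased P).prod (Measure.infinitePi fun _ : ℕ => π)).map
      (pairStep β₁ B₁ β₂ B₂)) ν₁ ν₂ := by
  have hm := measurable_pairStep β₁ B₁ β₂ B₂
  have e1 : (((sizeBiased P).prod (Measure.infinitePi fun _ : ℕ => π)).map
      (pairStep β₁ B₁ β₂ B₂)).map Prod.fst = ν₁ := by
    rw [Measure.map_map measurable_fst hm]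
    conv_rhs => rw [← h₁.fixed, treeRecursion, ← h.prod_map_fst,
      Measure.map_map (measurable_treeStep _ _) (by fun_prop)]
    rfl
  have e2 : (((sizeBiased P).prod (Measure.infinitePi fun _ : ℕ => π)).map
      (pairStep β₁ B₁ β₂ B₂)).map Prod.snd = ν₂ := by
    rw [Measure.map_map measurable_snd hm]
    conv_rhs => rw [← h₂.fixed, treeRecursion, ← h.prod_map_snd,
      Measure.map_map (measurable_treeStep _ _) (by fun_prop)]
    rfl
  -- The total mass is read off the first marginal, so `sizeBiased P` need not be known to be a
  -- probability measure here.
  refine ⟨⟨?_⟩, e1, e2⟩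
  have := h₁.isProbabilityMeasure.measure_univ
  rwa [← e1, Measure.map_apply measurable_fst MeasurableSet.univ, Set.preimage_univ] at this

theorem ae_pairStep {P : PMF ℕ} {β₁ B₁ β₂ B₂ r : ℝ} {π : Measure (ℝ × ℝ)}
    [IsProbabilityMeasure π] (hB₁ : B₁ ≤ Real.exp r * B₂) (hB₂ : B₂ ≤ Real.exp r * B₁)
    (h : ∀ᵐ p ∂π, message β₁ p.1 ≤ Real.exp r * message β₂ p.2 ∧
      message β₂ p.2 ≤ Real.exp r * message β₁ p.1) :
    ∀ᵐ p ∂(((sizeBiased P).prod (Measure.infinitePi fun _ : ℕ => π)).map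
      (pairStep β₁ B₁ β₂ B₂)), p.1 ≤ Real.exp r * p.2 ∧ p.2 ≤ Real.exp r * p.1 := by
  rw [ae_map_iff (measurable_pairStep _ _ _ _).aemeasurable]
  · have h2 := (Measure.quasiMeasurePreserving_snd (μ := sizeBiased P)).ae (ae_forall_infinitePi h)
    filter_upwards [h2] with x hx
    simp only [pairStep, treeStep_eq, mul_add, Finset.mul_sum]
    exact ⟨add_le_add hB₁ (Finset.sum_le_sum fun i _ => (hx i).1),
      add_le_add hB₂ (Finset.sum_le_sum fun i _ => (hx i).2)⟩
  · exact (measurableSet_le measurable_fst (measurable_snd.const_mul _)).inter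
      (measurableSet_le measurable_snd (measurable_fst.const_mul _))

/-- The parameter change consumes `s` of the log-ratio without contraction; the excess `r - s` is
contracted by `1 - c`. -/
theorem message_le_of_ratio {β β' m s r c x x' : ℝ} (hβ : 0 < β) (hsr : s ≤ r)
    (hc : ∀ y u : ℝ, m ≤ y → 0 ≤ u →
      message β (Real.exp u * y) ≤ Real.exp ((1 - c) * u) * message β y)
    (H : message β' x' ≤ Real.exp s * message β (Real.exp (-s) * x')) (hx : m ≤ x)
    (hxx : x' ≤ Real.exp r * x) :
    message β' x' ≤ Real.exp (s + (1 - c) * (r - s)) * message β x := by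
  have h1 : Real.exp (-s) * x' ≤ Real.exp (r - s) * x := by
    have := mul_le_mul_of_nonneg_left hxx (Real.exp_pos (-s)).le
    rwa [← mul_assoc, ← Real.exp_add, neg_add_eq_sub] at this
  calc message β' x' ≤ Real.exp s * message β (Real.exp (-s) * x') := H
    _ ≤ Real.exp s * (Real.exp ((1 - c) * (r - s)) * message β x) :=
      mul_le_mul_of_nonneg_left ((message_mono hβ.le h1).trans (hc x (r - s) hx (by linarith)))
        (Real.exp_pos s).le
    _ = _ := by rw [Real.exp_add, mul_assoc]

/-- Two tree fixed points can be coupled within any ratio exceeding `exp s`, if one application of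
the recursions keeps the ratio `exp s`. -/
theorem exists_coupling_ratio {P : PMF ℕ} {β₁ B₁ β₂ B₂ m s : ℝ} {ν₁ ν₂ : Measure ℝ}
    (hβ₁ : 0 < β₁) (hβ₂ : 0 < β₂) (hm : 0 < m) (hmB₁ : m ≤ B₁) (hmB₂ : m ≤ B₂)
    (hB₁ : B₁ ≤ Real.exp s * B₂) (hB₂ : B₂ ≤ Real.exp s * B₁)
    (H₁ : ∀ x, m ≤ x → message β₁ x ≤ Real.exp s * message β₂ (Real.exp (-s) * x))
    (H₂ : ∀ x, m ≤ x → message β₂ x ≤ Real.exp s * message β₁ (Real.exp (-s) * x))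
    (h₁ : IsTreeFixedPoint P β₁ B₁ ν₁) (h₂ : IsTreeFixedPoint P β₂ B₂ ν₂) {ε : ℝ} (hε : 0 < ε) :
    ∃ π, IsCoupling π ν₁ ν₂ ∧ ∀ᵐ p ∂π, p.1 ≤ Real.exp (s + ε) * p.2 ∧
      p.2 ≤ Real.exp (s + ε) * p.1 := by
  have := h₁.isProbabilityMeasure
  have := h₂.isProbabilityMeasure
  obtain ⟨c₁, hc₁, hc₁', hcon₁⟩ := exists_message_contraction hβ₁ hm
  obtain ⟨c₂, hc₂, hc₂', hcon₂⟩ := exists_message_contraction hβ₂ hm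
  set c := min c₁ c₂ with hc
  have hc0 : 0 < c := lt_min hc₁ hc₂
  have hc1 : c < 1 := (min_le_left _ _).trans_lt hc₁'
  have con : ∀ β c', 0 < β → c ≤ c' → (∀ y u : ℝ, m ≤ y → 0 ≤ u →
      message β (Real.exp u * y) ≤ Real.exp ((1 - c') * u) * message β y) →
      ∀ y u : ℝ, m ≤ y → 0 ≤ u →
      message β (Real.exp u * y) ≤ Real.exp ((1 - c) * u) * message β y := by
    intro β c' hβ hcc h y u hy hu
    refine (h y u hy hu).trans (mul_le_mul_of_nonneg_right (Real.exp_le_exp.2 ?_)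
      (message_nonneg hβ.le (by linarith)))
    nlinarith
  have con₁ := con β₁ c₁ hβ₁ (min_le_left _ _) hcon₁
  have con₂ := con β₂ c₂ hβ₂ (min_le_right _ _) hcon₂
  have a₁ := h₁.ae_le hβ₁.le
  have a₂ := h₂.ae_le hβ₂.le
  have hg₁ := message_pos hβ₁ hm
  have hg₂ := message_pos hβ₂ hm
  -- Messages from fields at least `m` lie between `message βᵢ m` and `βᵢ`, so one step from any
  -- coupling already has a bounded ratio.
  obtain ⟨r₀, hr₀s, hr₁, hr₂⟩ : ∃ r₀, s ≤ r₀ ∧ β₁ ≤ Real.exp r₀ * message β₂ m ∧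
      β₂ ≤ Real.exp r₀ * message β₁ m := by
    refine ⟨max s (max (Real.log (β₁ / message β₂ m)) (Real.log (β₂ / message β₁ m))),
      le_max_left _ _, ?_, ?_⟩
    · rw [← div_le_iff₀ hg₂, ← Real.log_le_iff_le_exp (by positivity)]
      exact (le_max_left _ _).trans (le_max_right _ _)
    · rw [← div_le_iff₀ hg₁, ← Real.log_le_iff_le_exp (by positivity)]
      exact (le_max_right _ _).trans (le_max_right _ _)
  have hB : ∀ r, s ≤ r → B₁ ≤ Real.exp r * B₂ ∧ B₂ ≤ Real.exp r * B₁ := fun r hr =>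
    ⟨hB₁.trans (mul_le_mul_of_nonneg_right (Real.exp_le_exp.2 hr) (by linarith)),
      hB₂.trans (mul_le_mul_of_nonneg_right (Real.exp_le_exp.2 hr) (by linarith))⟩
  have ind : ∀ n : ℕ, ∃ π, IsCoupling π ν₁ ν₂ ∧ ∀ᵐ p ∂π,
      p.1 ≤ Real.exp (s + (1 - c) ^ n * (r₀ - s)) * p.2 ∧
      p.2 ≤ Real.exp (s + (1 - c) ^ n * (r₀ - s)) * p.1 := by
    intro n
    induction n with
    | zero =>
      have hπ := isCoupling_prod ν₁ ν₂
      refine ⟨_, hπ.step h₁ h₂, ?_⟩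
      rw [pow_zero, one_mul, add_sub_cancel]
      refine ae_pairStep (hB _ hr₀s).1 (hB _ hr₀s).2 ?_
      filter_upwards [hπ.ae_fst a₁, hπ.ae_snd a₂] with p hp₁ hp₂
      constructor
      · refine ((message_le_left hβ₁.le).trans hr₁).trans ?_
        exact mul_le_mul_of_nonneg_left (message_mono hβ₂.le (hmB₂.trans hp₂)) (Real.exp_pos _).le
      · refine ((message_le_left hβ₂.le).trans hr₂).trans ?_
        exact mul_le_mul_of_nonneg_left (message_mono hβ₁.le (hmB₁.trans hp₁)) (Real.exp_pos _).le
    | succ n ih =>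
      obtain ⟨π, hπ, hr⟩ := ih
      have := hπ.isProbabilityMeasure
      have hnn : 0 ≤ (1 - c) ^ n * (r₀ - s) :=
        mul_nonneg (pow_nonneg (by linarith) _) (by linarith)
      have e : s + (1 - c) ^ (n + 1) * (r₀ - s) =
          s + (1 - c) * (s + (1 - c) ^ n * (r₀ - s) - s) := by ring
      have hnn' : 0 ≤ (1 - c) ^ (n + 1) * (r₀ - s) :=
        mul_nonneg (pow_nonneg (by linarith) _) (by linarith)
      refine ⟨_, hπ.step h₁ h₂, ae_pairStep (hB _ (by linarith)).1 (hB _ (by linarith)).2 ?_⟩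
      filter_upwards [hπ.ae_fst a₁, hπ.ae_snd a₂, hr] with p hp₁ hp₂ hp
      rw [e]
      exact ⟨message_le_of_ratio hβ₂ (by linarith) con₂ (H₁ _ (hmB₁.trans hp₁))
        (hmB₂.trans hp₂) hp.1, message_le_of_ratio hβ₁ (by linarith) con₁ (H₂ _ (hmB₂.trans hp₂))
        (hmB₁.trans hp₁) hp.2⟩
  have lim : Filter.Tendsto (fun n : ℕ => (1 - c) ^ n * (r₀ - s)) Filter.atTop (nhds 0) := by
    simpa using (tendsto_pow_atTop_nhds_zero_of_lt_one (by linarith : 0 ≤ 1 - c)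
      (by linarith)).mul_const (r₀ - s)
  -- Stopping at a finite `n`, at the price of `ε`, avoids taking a limit of couplings.
  obtain ⟨n, hn⟩ := (lim.eventually (gt_mem_nhds hε)).exists
  obtain ⟨π, hπ, hr⟩ := ind n
  refine ⟨π, hπ, ?_⟩
  filter_upwards [hr, hπ.ae_fst a₁, hπ.ae_snd a₂] with p hp hp₁ hp₂
  have hexp : Real.exp (s + (1 - c) ^ n * (r₀ - s)) ≤ Real.exp (s + ε) :=
    Real.exp_le_exp.2 (by linarith)
  exact ⟨hp.1.trans (mul_le_mul_of_nonneg_right hexp (by linarith)),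
    hp.2.trans (mul_le_mul_of_nonneg_right hexp (by linarith))⟩

/-- The same, measured through `tanh`. -/
theorem exists_coupling_tanh {P : PMF ℕ} {β₁ B₁ β₂ B₂ m s : ℝ} {ν₁ ν₂ : Measure ℝ}
    (hβ₁ : 0 < β₁) (hβ₂ : 0 < β₂) (hm : 0 < m) (hmB₁ : m ≤ B₁) (hmB₂ : m ≤ B₂) (hs : 0 ≤ s)
    (hB₁ : B₁ ≤ Real.exp s * B₂) (hB₂ : B₂ ≤ Real.exp s * B₁)
    (H₁ : ∀ x, m ≤ x → message β₁ x ≤ Real.exp s * message β₂ (Real.exp (-s) * x))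
    (H₂ : ∀ x, m ≤ x → message β₂ x ≤ Real.exp s * message β₁ (Real.exp (-s) * x))
    (h₁ : IsTreeFixedPoint P β₁ B₁ ν₁) (h₂ : IsTreeFixedPoint P β₂ B₂ ν₂) {ε : ℝ} (hε : 0 < ε) :
    ∃ π, IsCoupling π ν₁ ν₂ ∧ ∀ᵐ p ∂π, |Real.tanh p.2 - Real.tanh p.1| ≤ s + ε := by
  obtain ⟨π, hπ, h⟩ := exists_coupling_ratio hβ₁ hβ₂ hm hmB₁ hmB₂ hB₁ hB₂ H₁ H₂ h₁ h₂ hε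
  refine ⟨π, hπ, ?_⟩
  filter_upwards [h, hπ.ae_fst h₁.nonneg, hπ.ae_snd h₂.nonneg] with p hp hp₁ hp₂
  have e1 := tanh_strictMono.monotone hp.1
  have e2 := tanh_strictMono.monotone hp.2
  have e3 := tanh_exp_mul_sub_le hp₁ (by linarith : 0 ≤ s + ε)
  have e4 := tanh_exp_mul_sub_le hp₂ (by linarith : 0 ≤ s + ε)
  rw [abs_le]
  constructor <;> linarith

/-! ### Expansion of `log (1 + u z)` in `u` -/

theorem abs_log_one_add_sub_le {t : ℝ} (ht : -(1 / 2) ≤ t) : |Real.log (1 + t) - t| ≤ 2 * t ^ 2 := by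
  have h0 : 0 < 1 + t := by linarith
  have h1 := Real.log_le_sub_one_of_pos h0
  have h2 := Real.one_sub_inv_le_log_of_pos h0
  have h3 : t - 2 * t ^ 2 ≤ 1 - (1 + t)⁻¹ := by
    rw [← sub_nonneg]
    have : 1 - (1 + t)⁻¹ - (t - 2 * t ^ 2) = t ^ 2 * (1 + 2 * t) / (1 + t) := by
      field_simp
      ring
    rw [this]
    have : 0 ≤ 1 + 2 * t := by linarith
    positivity
  rw [abs_le]
  constructor <;> nlinarith [sq_nonneg t]

theorem log_one_add_mul_sub {u v z : ℝ} (hu : 0 ≤ u) (hv : 0 ≤ v) (hz : 0 ≤ z) :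
    Real.log (1 + v * z) - Real.log (1 + u * z) = Real.log (1 + (v - u) * z / (1 + u * z)) := by
  have h1 : 0 < 1 + u * z := by positivity
  have h2 : 0 < 1 + v * z := by positivity
  rw [← Real.log_div h2.ne' h1.ne']
  congr 1
  field_simp
  ring

theorem abs_log_one_add_mul_sub_le {u v z : ℝ} (hu : 0 ≤ u) (hv : 0 ≤ v) (hz : 0 ≤ z)
    (hz1 : z ≤ 1) : |Real.log (1 + v * z) - Real.log (1 + u * z)| ≤ |v - u| := by
  have key : ∀ a b : ℝ, 0 ≤ a → 0 ≤ b →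
      Real.log (1 + b * z) - Real.log (1 + a * z) ≤ |b - a| := by
    intro a b ha hb
    have h1 : 0 < 1 + a * z := by positivity
    have h2 : 0 < 1 + b * z := by positivity
    have h3 : 0 < 1 + (b - a) * z / (1 + a * z) := by
      have : 1 + (b - a) * z / (1 + a * z) = (1 + b * z) / (1 + a * z) := by
        field_simp
        ring
      rw [this]
      positivity
    rw [log_one_add_mul_sub ha hb hz]
    refine (Real.log_le_sub_one_of_pos h3).trans ?_
    rw [add_sub_cancel_left, div_le_iff₀ h1]
    have h4 := le_abs_self (b - a)
    have h5 := abs_nonneg (b - a)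
    have h6 : 0 ≤ a * z := by positivity
    nlinarith [mul_le_mul_of_nonneg_right h4 hz, mul_le_mul_of_nonneg_left hz1 h5,
      mul_nonneg h5 h6]
  rw [abs_le]
  have h1 := key u v hu hv
  have h2 := key v u hv hu
  rw [abs_sub_comm] at h2
  constructor <;> linarith

theorem div_one_add_mul_mem {u z : ℝ} (hu : 0 ≤ u) (hz : 0 ≤ z) (hz1 : z ≤ 1) :
    z / (1 + u * z) ∈ Set.Icc (0 : ℝ) 1 := by
  have : 0 ≤ u * z := by positivity
  refine ⟨by positivity, ?_⟩
  rw [div_le_one (by linarith)]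
  linarith

theorem abs_mul_div_one_add_mul_le {u d z : ℝ} (hu : 0 ≤ u) (hz : 0 ≤ z) (hz1 : z ≤ 1) :
    |d * (z / (1 + u * z))| ≤ |d| := by
  obtain ⟨h1, h2⟩ := div_one_add_mul_mem hu hz hz1
  rw [abs_mul, abs_of_nonneg h1]
  exact mul_le_of_le_one_right (abs_nonneg _) h2

theorem abs_div_one_add_mul_sub_le {u z z' : ℝ} (hu : 0 ≤ u) (hz : 0 ≤ z) (hz' : 0 ≤ z') :
    |z / (1 + u * z) - z' / (1 + u * z')| ≤ |z - z'| := by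
  have h1 : 0 ≤ u * z := by positivity
  have h2 : 0 ≤ u * z' := by positivity
  have : z / (1 + u * z) - z' / (1 + u * z') = (z - z') / ((1 + u * z) * (1 + u * z')) := by
    field_simp
    ring
  rw [this, abs_div]
  refine div_le_self (abs_nonneg _) ?_
  rw [abs_of_nonneg (by positivity)]
  nlinarith

/-- The gradient is taken at `z'` while the increment is at `z`: this mismatch occurs when
coordinates are changed one at a time but the gradient stays at the starting point. -/
theorem abs_log_one_add_mul_remainder_le {u v z z' : ℝ} (hu : 0 ≤ u) (hu1 : u ≤ 1) (hv : 0 ≤ v)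
    (hz : 0 ≤ z) (hz1 : z ≤ 1) (hz' : 0 ≤ z') :
    |Real.log (1 + v * z) - Real.log (1 + u * z) - (v - u) * (z' / (1 + u * z'))| ≤
      |v - u| * (2 * |v - u| + |z - z'|) := by
  have huz : 0 ≤ u * z := by positivity
  have huz1 : u * z ≤ 1 := mul_le_one₀ hu1 hz hz1
  set t := (v - u) * z / (1 + u * z) with ht
  have ht' : t = (v - u) * (z / (1 + u * z)) := by rw [ht]; ring
  -- Since `v ≥ 0` and `u z ≤ 1`, `t ≥ -u z / (1 + u z) ≥ -1 / 2`; no smallness of `v - u` is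
  -- needed.
  have h1 : -(1 / 2) ≤ t := by
    rw [ht, le_div_iff₀ (by linarith)]
    have : 0 ≤ v * z := by positivity
    nlinarith
  have h2 : |t| ≤ |v - u| := by
    rw [ht']
    exact abs_mul_div_one_add_mul_le hu hz hz1
  have h3 : t ^ 2 ≤ |v - u| * |v - u| := by
    rw [← sq_abs, pow_two]
    exact mul_self_le_mul_self (abs_nonneg _) h2
  have h4 := abs_log_one_add_sub_le h1
  have h5 : |t - (v - u) * (z' / (1 + u * z'))| ≤ |v - u| * |z - z'| := by
    rw [ht', ← mul_sub, abs_mul]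
    exact mul_le_mul_of_nonneg_left (abs_div_one_add_mul_sub_le hu hz hz') (abs_nonneg _)
  rw [log_one_add_mul_sub hu hv hz]
  have h6 := abs_sub_le (Real.log (1 + t)) t ((v - u) * (z' / (1 + u * z')))
  linarith

/-! ### Taylor expansion of the vertex term -/

/-- The magnetization of a vertex in the field `B` that receives the messages `artanh (u i)`. -/
def cavityMag (B : ℝ) (s : Finset ℕ) (u : ℕ → ℝ) : ℝ :=
  Real.tanh (B + ∑ i ∈ s, Real.artanh (u i))

theorem cavityMag_mem {B : ℝ} (hB : 0 ≤ B) (s : Finset ℕ) {u : ℕ → ℝ} (hu : ∀ i, 0 ≤ u i) :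
    cavityMag B s u ∈ Set.Icc (0 : ℝ) 1 :=
  ⟨tanh_nonneg' (add_nonneg hB (Finset.sum_nonneg fun i _ => Real.artanh_nonneg (hu i))),
    (Real.tanh_lt_one _).le⟩

theorem cavityMag_insert (B : ℝ) {s : Finset ℕ} {m : ℕ} (hm : m ∉ s) {u : ℕ → ℝ}
    (hu : u m ∈ Set.Ico (0 : ℝ) 1) : cavityMag B (insert m s) u =
      (cavityMag B s u + u m) / (1 + cavityMag B s u * u m) := by
  have : Real.tanh (Real.artanh (u m)) = u m :=
    Real.tanh_artanh ⟨by linarith [hu.1], hu.2⟩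
  rw [cavityMag, Finset.sum_insert hm, add_comm (Real.artanh (u m)), ← add_assoc, tanh_add, this]
  rfl

/-- Messages are added by `(z, a) ↦ (z + a) / (1 + z a)`, which is 1-Lipschitz in each argument on
the unit square. -/
theorem abs_cavityMag_sub_le {B : ℝ} (hB : 0 ≤ B) (s : Finset ℕ) {u v : ℕ → ℝ}
    (hu : ∀ i, u i ∈ Set.Ico (0 : ℝ) 1) (hv : ∀ i, v i ∈ Set.Ico (0 : ℝ) 1) :
    |cavityMag B s u - cavityMag B s v| ≤ ∑ i ∈ s, |u i - v i| := by
  induction s using Finset.induction_on with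
  | empty => simp [cavityMag]
  | insert m s hm ih =>
    rw [cavityMag_insert B hm (hu m), cavityMag_insert B hm (hv m), Finset.sum_insert hm]
    obtain ⟨z0, z1⟩ := cavityMag_mem hB s fun i => (hu i).1
    obtain ⟨w0, w1⟩ := cavityMag_mem hB s fun i => (hv i).1
    set z := cavityMag B s u
    set w := cavityMag B s v
    obtain ⟨a0, a1⟩ := hu m
    obtain ⟨b0, b1⟩ := hv m
    set a := u m
    set b := v m
    have e : (z + a) / (1 + z * a) - (w + b) / (1 + w * b) =
        (z - w) * ((1 - a ^ 2) / ((1 + z * a) * (1 + w * a))) +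
        (a - b) * ((1 - w ^ 2) / ((1 + w * a) * (1 + w * b))) := by
      have p1 : 1 + z * a ≠ 0 := by positivity
      have p2 : 1 + w * a ≠ 0 := by positivity
      have p3 : 1 + w * b ≠ 0 := by positivity
      field_simp
      ring
    have bound : ∀ d x p q : ℝ, 0 ≤ x → x ≤ 1 → 0 ≤ p → 0 ≤ q →
        |d * ((1 - x ^ 2) / ((1 + p) * (1 + q)))| ≤ |d| := by
      intro d x p q hx hx1 hp hq
      have h1 : 0 ≤ 1 - x ^ 2 := by nlinarith
      have h2 : 0 ≤ (1 - x ^ 2) / ((1 + p) * (1 + q)) := by positivity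
      rw [abs_mul, abs_of_nonneg h2]
      refine mul_le_of_le_one_right (abs_nonneg _) ?_
      rw [div_le_one (by positivity)]
      nlinarith [mul_nonneg hp hq]
    rw [e]
    refine (abs_add_le _ _).trans ?_
    have h1 := bound (z - w) a (z * a) (w * a) a0 a1.le (by positivity) (by positivity)
    have h2 := bound (a - b) w (w * a) (w * b) w0 w1 (by positivity) (by positivity)
    linarith

/-- `e^B ∏ (1 + u i) + e^{-B} ∏ (1 - u i)`. -/
def vertexWeight (B : ℝ) (s : Finset ℕ) (u : ℕ → ℝ) : ℝ :=
  Real.exp B * ∏ i ∈ s, (1 + u i) + Real.exp (-B) * ∏ i ∈ s, (1 - u i)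

theorem vertexWeight_pos (B : ℝ) (s : Finset ℕ) {u : ℕ → ℝ} (hu : ∀ i, u i ∈ Set.Ico (0 : ℝ) 1) :
    0 < vertexWeight B s u := by
  have h1 : 0 < ∏ i ∈ s, (1 + u i) := Finset.prod_pos fun i _ => by linarith [(hu i).1]
  have h2 : 0 < ∏ i ∈ s, (1 - u i) := Finset.prod_pos fun i _ => by linarith [(hu i).2]
  unfold vertexWeight
  positivity

theorem vertexWeight_congr (B : ℝ) {s : Finset ℕ} {u v : ℕ → ℝ} (h : ∀ i ∈ s, u i = v i) :
    vertexWeight B s u = vertexWeight B s v := by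
  have h1 : ∏ i ∈ s, (1 + u i) = ∏ i ∈ s, (1 + v i) :=
    Finset.prod_congr rfl fun i hi => by rw [h i hi]
  have h2 : ∏ i ∈ s, (1 - u i) = ∏ i ∈ s, (1 - v i) :=
    Finset.prod_congr rfl fun i hi => by rw [h i hi]
  rw [vertexWeight, h1, h2, vertexWeight]

/-- The magnetization is the difference of the plus and minus spin weights over their sum; the
addition law of `tanh` propagates this from one message to the next. -/
theorem cavityMag_mul_vertexWeight (B : ℝ) (s : Finset ℕ) {u : ℕ → ℝ}
    (hu : ∀ i, u i ∈ Set.Ico (0 : ℝ) 1) : cavityMag B s u * vertexWeight B s u =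
      Real.exp B * ∏ i ∈ s, (1 + u i) - Real.exp (-B) * ∏ i ∈ s, (1 - u i) := by
  induction s using Finset.induction_on with
  | empty =>
    have := add_pos (Real.exp_pos B) (Real.exp_pos (-B))
    simp only [cavityMag, vertexWeight, Finset.sum_empty, Finset.prod_empty, add_zero, mul_one,
      Real.tanh_eq]
    field_simp
  | insert m s hm ih =>
    have hz : 0 < 1 + cavityMag B s u * u m := by
      have h1 : -1 < cavityMag B s u := Real.neg_one_lt_tanh _
      obtain ⟨h2, h3⟩ := hu m
      nlinarith
    have hw : vertexWeight B (insert m s) u =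
        vertexWeight B s u * (1 + cavityMag B s u * u m) := by
      rw [mul_add, mul_one, ← mul_assoc, mul_comm (vertexWeight B s u), ih]
      simp only [vertexWeight, Finset.prod_insert hm]
      ring
    rw [hw, cavityMag_insert B hm (hu m), Finset.prod_insert hm, Finset.prod_insert hm]
    have : (cavityMag B s u + u m) / (1 + cavityMag B s u * u m) *
        (vertexWeight B s u * (1 + cavityMag B s u * u m)) =
        cavityMag B s u * vertexWeight B s u + u m * vertexWeight B s u := by
      field_simp
    rw [this, ih, vertexWeight]
    ring

/-- The weight is affine in each message with slope the magnetization due to the others. After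
taking logarithms, one message enters the vertex term exactly as it enters an edge term against the
cavity field. -/
theorem vertexWeight_insert (B : ℝ) {s : Finset ℕ} {m : ℕ} (hm : m ∉ s) {u : ℕ → ℝ}
    (hu : ∀ i, u i ∈ Set.Ico (0 : ℝ) 1) : vertexWeight B (insert m s) u =
      vertexWeight B s u * (1 + u m * cavityMag B s u) := by
  have h := cavityMag_mul_vertexWeight B s hu
  rw [mul_add, mul_one, mul_comm (u m), ← mul_assoc, mul_comm (vertexWeight B s u), h]
  simp only [vertexWeight, Finset.prod_insert hm]
  ring

theorem log_vertexWeight_insert {B : ℝ} (hB : 0 ≤ B) {s : Finset ℕ} {m : ℕ} (hm : m ∉ s)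
    {u : ℕ → ℝ} (hu : ∀ i, u i ∈ Set.Ico (0 : ℝ) 1) : Real.log (vertexWeight B (insert m s) u) =
      Real.log (vertexWeight B s u) + Real.log (1 + u m * cavityMag B s u) := by
  have h1 := (cavityMag_mem hB s fun i => (hu i).1).1
  have h2 := (hu m).1
  rw [vertexWeight_insert B hm hu, Real.log_mul (vertexWeight_pos B s hu).ne' (by positivity)]

theorem log_vertexWeight_update_sub {B : ℝ} (hB : 0 ≤ B) {s : Finset ℕ} {m : ℕ} (hm : m ∈ s)
    {w w' : ℕ → ℝ} (hw : ∀ i, w i ∈ Set.Ico (0 : ℝ) 1) (hw' : ∀ i, w' i ∈ Set.Ico (0 : ℝ) 1)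
    (hww : ∀ i, i ≠ m → w' i = w i) :
    Real.log (vertexWeight B s w') - Real.log (vertexWeight B s w) =
      Real.log (1 + w' m * cavityMag B (s.erase m) w) -
        Real.log (1 + w m * cavityMag B (s.erase m) w) := by
  rw [← Finset.insert_erase hm, log_vertexWeight_insert hB (Finset.notMem_erase m s) hw,
    log_vertexWeight_insert hB (Finset.notMem_erase m s) hw', Finset.insert_erase hm]
  have e1 : cavityMag B (s.erase m) w' = cavityMag B (s.erase m) w := by
    unfold cavityMag
    rw [Finset.sum_congr rfl fun i hi => by rw [hww i (Finset.ne_of_mem_erase hi)]]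
  have e2 : vertexWeight B (s.erase m) w' = vertexWeight B (s.erase m) w :=
    vertexWeight_congr B fun i hi => hww i (Finset.ne_of_mem_erase hi)
  rw [e1, e2]
  ring

/-- The first-order term of `log (vertexWeight B (range k) ·)` at `u` in the direction `v - u`. -/
def vertexGrad (B : ℝ) (k : ℕ) (u v : ℕ → ℝ) : ℝ :=
  ∑ m ∈ Finset.range k, (v m - u m) * (cavityMag B ((Finset.range k).erase m) u /
    (1 + u m * cavityMag B ((Finset.range k).erase m) u))

section Taylor

variable {B δ : ℝ} {u v : ℕ → ℝ}

theorem abs_vertexGrad_le (hB : 0 ≤ B) (hu : ∀ i, u i ∈ Set.Ico (0 : ℝ) 1)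
    (hδ : ∀ i, |v i - u i| ≤ δ) (k : ℕ) : |vertexGrad B k u v| ≤ k * δ := by
  refine (Finset.abs_sum_le_sum_abs _ _).trans ?_
  refine (Finset.sum_le_card_nsmul _ _ δ fun m _ => ?_).trans (by simp)
  obtain ⟨h1, h2⟩ := cavityMag_mem hB ((Finset.range k).erase m) fun i => (hu i).1
  exact (abs_mul_div_one_add_mul_le (hu m).1 h1 h2).trans (hδ m)

/-- Replace `u` by `v` one coordinate at a time; before the `m`-th replacement the coordinates below
`m` already come from `v`. -/
theorem log_vertexWeight_telescope (hB : 0 ≤ B) (hu : ∀ i, u i ∈ Set.Ico (0 : ℝ) 1)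
    (hv : ∀ i, v i ∈ Set.Ico (0 : ℝ) 1) (k : ℕ) :
    Real.log (vertexWeight B (Finset.range k) v) - Real.log (vertexWeight B (Finset.range k) u) =
      ∑ m ∈ Finset.range k,
        (Real.log (1 + v m * cavityMag B ((Finset.range k).erase m)
            (fun j => if j < m then v j else u j)) -
          Real.log (1 + u m * cavityMag B ((Finset.range k).erase m)
            (fun j => if j < m then v j else u j))) := by
  set w : ℕ → ℕ → ℝ := fun m j => if j < m then v j else u j with hw
  have hwI : ∀ m i, w m i ∈ Set.Ico (0 : ℝ) 1 := fun m i => by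
    simp only [hw]
    split_ifs
    exacts [hv i, hu i]
  have e0 : w 0 = u := by funext j; simp [hw]
  have ek : vertexWeight B (Finset.range k) (w k) = vertexWeight B (Finset.range k) v :=
    vertexWeight_congr B fun i hi => by simp [hw, Finset.mem_range.1 hi]
  have tel := Finset.sum_range_sub (fun m => Real.log (vertexWeight B (Finset.range k) (w m))) k
  rw [e0, ek] at tel
  rw [← tel]
  refine Finset.sum_congr rfl fun m hm => ?_
  rw [log_vertexWeight_update_sub hB hm (hwI m) (hwI (m + 1)) fun i hi => ?_]
  · simp [hw]
  · simp only [hw]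
    have : i < m + 1 ↔ i < m := by omega
    simp [this]

/-- Taylor bound for the vertex term, linear for large `k * δ` and quadratic for small `k * δ`. -/
theorem abs_vertex_remainder_le (hB : 0 ≤ B) (hu : ∀ i, u i ∈ Set.Ico (0 : ℝ) 1)
    (hv : ∀ i, v i ∈ Set.Ico (0 : ℝ) 1) (hδ : ∀ i, |v i - u i| ≤ δ) (k : ℕ) :
    |Real.log (vertexWeight B (Finset.range k) v) - Real.log (vertexWeight B (Finset.range k) u) -
      vertexGrad B k u v| ≤ 3 * min (k * δ) ((k * δ) ^ 2) := by
  have hδ0 : 0 ≤ δ := (abs_nonneg _).trans (hδ 0)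
  have hwI : ∀ m i, (if i < m then v i else u i) ∈ Set.Ico (0 : ℝ) 1 := fun m i => by
    split_ifs
    exacts [hv i, hu i]
  rw [log_vertexWeight_telescope hB hu hv, mul_min_of_nonneg _ _ (by norm_num), le_min_iff]
  constructor
  -- Linear regime: the increment and the gradient are each at most `k * δ`.
  · refine (abs_sub _ _).trans ?_
    have h1 := abs_vertexGrad_le hB hu hδ k
    have h2 : |∑ m ∈ Finset.range k,
        (Real.log (1 + v m * cavityMag B ((Finset.range k).erase m)
            (fun j => if j < m then v j else u j)) -
          Real.log (1 + u m * cavityMag B ((Finset.range k).erase m)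
            (fun j => if j < m then v j else u j)))| ≤ k * δ := by
      refine (Finset.abs_sum_le_sum_abs _ _).trans ?_
      refine (Finset.sum_le_card_nsmul _ _ δ fun m _ => ?_).trans (by simp)
      obtain ⟨h1, h2⟩ := cavityMag_mem hB ((Finset.range k).erase m) fun i => (hwI m i).1
      exact (abs_log_one_add_mul_sub_le (hu m).1 (hv m).1 h1 h2).trans (hδ m)
    have : 0 ≤ k * δ := by positivity
    linarith
  · rw [vertexGrad, ← Finset.sum_sub_distrib]
    refine (Finset.abs_sum_le_sum_abs _ _).trans ?_
    -- Quadratic regime: cavity magnetizations move by at most `k * δ`, so each of the `k` terms has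
    -- error at most `δ (2δ + kδ) ≤ 3kδ²`.
    refine (Finset.sum_le_card_nsmul _ _ (3 * k * δ ^ 2) fun m hm => ?_).trans (le_of_eq ?_)
    · obtain ⟨h1, h2⟩ := cavityMag_mem hB ((Finset.range k).erase m) fun i => (hwI m i).1
      obtain ⟨h3, -⟩ := cavityMag_mem hB ((Finset.range k).erase m) fun i => (hu i).1
      refine (abs_log_one_add_mul_remainder_le (hu m).1 (hu m).2.le (hv m).1 h1 h2 h3).trans ?_
      have h4 : ∑ i ∈ (Finset.range k).erase m, |(if i < m then v i else u i) - u i| ≤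
          k * δ := by
        have : ∀ i, |(if i < m then v i else u i) - u i| ≤ δ := fun i => by
          split_ifs
          · exact hδ i
          · simpa using hδ0
        refine (Finset.sum_le_card_nsmul _ _ δ fun i _ => this i).trans ?_
        rw [nsmul_eq_mul]
        refine mul_le_mul_of_nonneg_right ?_ hδ0
        exact_mod_cast (Finset.card_erase_le).trans (Finset.card_range k).le
      have h5 := (abs_cavityMag_sub_le hB ((Finset.range k).erase m) (hwI m) hu).trans h4
      have h6 := hδ m
      have h7 : (1 : ℝ) ≤ k := by
        have := Finset.mem_range.1 hm
        exact_mod_cast (by omega : 1 ≤ k)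
      calc _ ≤ δ * (2 * δ + k * δ) :=
            mul_le_mul h6 (by linarith) (by positivity) hδ0
        _ ≤ 3 * k * δ ^ 2 := by nlinarith [mul_nonneg hδ0 hδ0]
    · rw [Finset.card_range, nsmul_eq_mul]
      ring

end Taylor

/-! ### Truncated moments from the tail bound -/

/-- A discrete integral comparison, by Bernoulli's inequality for `(1 - 1 / x) ^ a` at `x = j + 1`.
-/
theorem rpow_sub_one_le_telescope {a : ℝ} (ha : 0 < a) (ha1 : a ≤ 1) (j : ℕ) :
    ((j : ℝ) + 1) ^ (a - 1) ≤ a⁻¹ * (((j : ℝ) + 1) ^ a - (j : ℝ) ^ a) := by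
  set x : ℝ := (j : ℝ) + 1 with hx
  have hx1 : 1 ≤ x := by rw [hx]; linarith [Nat.cast_nonneg (α := ℝ) j]
  have hx0 : 0 < x := by linarith
  have h1 : (1 + -x⁻¹) ^ a ≤ 1 + a * -x⁻¹ :=
    rpow_one_add_le_one_add_mul_self (by linarith [inv_le_one_of_one_le₀ hx1]) ha.le ha1
  have h2 : (j : ℝ) = x * (1 + -x⁻¹) := by
    rw [mul_add, mul_neg, mul_inv_cancel₀ hx0.ne', hx]
    ring
  have h3 : 0 ≤ 1 + -x⁻¹ := by linarith [inv_le_one_of_one_le₀ hx1]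
  rw [h2, Real.mul_rpow hx0.le h3, Real.rpow_sub_one hx0.ne', inv_mul_eq_div, le_div_iff₀ ha]
  have h4 := mul_le_mul_of_nonneg_left h1 (Real.rpow_pos_of_pos hx0 a).le
  rw [div_eq_mul_inv]
  linarith

theorem rpow_neg_sub_one_le_telescope {b : ℝ} (hb : 0 < b) (hb1 : b ≤ 1) {j : ℕ} (hj : 1 ≤ j) :
    ((j : ℝ) + 1) ^ (-b - 1) ≤ b⁻¹ * ((j : ℝ) ^ (-b) - ((j : ℝ) + 1) ^ (-b)) := by
  have hj' : (1 : ℝ) ≤ j := by exact_mod_cast hj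
  set x : ℝ := (j : ℝ) + 1 with hx
  have hx1 : 1 < x := by rw [hx]; linarith
  have hx0 : 0 < x := by linarith
  have hi1 : x⁻¹ < 1 := inv_lt_one_of_one_lt₀ hx1
  have hi0 : 0 < x⁻¹ := inv_pos.2 hx0
  have h1 : (1 + -x⁻¹) ^ b ≤ 1 + b * -x⁻¹ :=
    rpow_one_add_le_one_add_mul_self (by linarith) hb.le hb1
  have h2 : (j : ℝ) = x * (1 + -x⁻¹) := by
    rw [mul_add, mul_neg, mul_inv_cancel₀ hx0.ne', hx]
    ring
  have h3 : 0 < 1 + -x⁻¹ := by linarith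
  have h4 : 1 + b * x⁻¹ ≤ (1 + -x⁻¹) ^ (-b) := by
    have h5 := Real.rpow_pos_of_pos h3 b
    rw [Real.rpow_neg h3.le, le_inv_comm₀ (by positivity) h5]
    refine h1.trans ?_
    rw [inv_eq_one_div (1 + b * x⁻¹), le_div_iff₀ (by positivity)]
    nlinarith [sq_nonneg (b * x⁻¹)]
  rw [h2, Real.mul_rpow hx0.le h3.le, Real.rpow_sub_one hx0.ne', inv_mul_eq_div, le_div_iff₀ hb]
  have h5 := mul_le_mul_of_nonneg_left h4 (Real.rpow_pos_of_pos hx0 (-b)).le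
  rw [div_eq_mul_inv]
  linarith

/-- Split at `j ≈ 1 / δ`. Below, `δ ∑ j ^ (2 - τ)` is of order `δ (1 / δ) ^ (3 - τ) = δ ^ (τ - 2)`,
using `τ < 3`; above, `∑ j ^ (1 - τ)` is of the same order, using `τ > 2`. The middle `1` in the
constant pays for the crossing term. -/
theorem sum_min_mul_rpow_le {τ : ℝ} (hτ₂ : 2 < τ) (hτ₃ : τ < 3) {δ : ℝ} (hδ : 0 < δ)
    (n : ℕ) :
    ∑ j ∈ Finset.range n, min (((j : ℝ) + 1) * δ) 1 * ((j : ℝ) + 1) ^ (-(τ - 1)) ≤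
      ((3 - τ)⁻¹ + 1 + (τ - 2)⁻¹) * δ ^ (τ - 2) := by
  have ha : 0 < 3 - τ := by linarith
  have hb : 0 < τ - 2 := by linarith
  have hD := Real.rpow_pos_of_pos hδ (τ - 2)
  have hsmall : ∀ n : ℕ, n * δ ≤ 1 → δ * (n : ℝ) ^ (3 - τ) ≤ δ ^ (τ - 2) := by
    intro n hn
    have h1 : (n : ℝ) ≤ δ⁻¹ := by rwa [← one_div, le_div_iff₀ hδ]
    have h2 := Real.rpow_le_rpow (Nat.cast_nonneg n) h1 ha.le
    have h3 : δ * δ⁻¹ ^ (3 - τ) = δ ^ (τ - 2) := by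
      rw [Real.inv_rpow hδ.le, ← Real.rpow_neg hδ.le]
      nth_rewrite 1 [← Real.rpow_one δ]
      rw [← Real.rpow_add hδ]
      congr 1
      ring
    rw [← h3]
    exact mul_le_mul_of_nonneg_left h2 hδ.le
  -- Past the threshold the bound carries the negative term `-(τ - 2)⁻¹ n ^ (-(τ - 2))`, so that
  -- each new summand is absorbed by telescoping.
  have key : ∑ j ∈ Finset.range n, min (((j : ℝ) + 1) * δ) 1 * ((j : ℝ) + 1) ^ (-(τ - 1)) ≤
      if n * δ ≤ 1 then (3 - τ)⁻¹ * (δ * (n : ℝ) ^ (3 - τ)) else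
        ((3 - τ)⁻¹ + 1 + (τ - 2)⁻¹) * δ ^ (τ - 2) - (τ - 2)⁻¹ * (n : ℝ) ^ (-(τ - 2)) := by
    induction n with
    | zero => simp [Real.zero_rpow ha.ne']
    | succ n ih =>
      rw [Finset.sum_range_succ]
      push_cast
      have hx0 : (0 : ℝ) < (n : ℝ) + 1 := by positivity
      have hpos := Real.rpow_pos_of_pos hx0 (-(τ - 1))
      by_cases h1 : ((n : ℝ) + 1) * δ ≤ 1
      · have h2 : n * δ ≤ 1 := by linarith
        rw [if_pos h2] at ih
        rw [if_pos h1, min_eq_left h1]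
        have t := rpow_sub_one_le_telescope ha (by linarith) n
        have e : ((n : ℝ) + 1) * δ * ((n : ℝ) + 1) ^ (-(τ - 1)) =
            δ * ((n : ℝ) + 1) ^ (3 - τ - 1) := by
          rw [show (3 : ℝ) - τ - 1 = 1 + -(τ - 1) by ring, Real.rpow_add hx0, Real.rpow_one]
          ring
        rw [e]
        have := mul_le_mul_of_nonneg_left t hδ.le
        linarith
      · rw [if_neg h1, min_eq_right (not_le.1 h1).le, one_mul]
        by_cases h2 : n * δ ≤ 1
        · rw [if_pos h2] at ih
          have s1 := hsmall n h2
          have h3 : δ⁻¹ ≤ (n : ℝ) + 1 := by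
            rw [← one_div, div_le_iff₀ hδ]
            exact (not_le.1 h1).le
          have s2 : ((n : ℝ) + 1) ^ (-(τ - 2)) ≤ δ ^ (τ - 2) := by
            have := Real.rpow_le_rpow_of_nonpos (inv_pos.2 hδ) h3 (by linarith : -(τ - 2) ≤ 0)
            rwa [Real.inv_rpow hδ.le, Real.rpow_neg hδ.le, inv_inv] at this
          have s3 : ((n : ℝ) + 1) ^ (-(τ - 1)) ≤ ((n : ℝ) + 1) ^ (-(τ - 2)) :=
            Real.rpow_le_rpow_of_exponent_le (by linarith [Nat.cast_nonneg (α := ℝ) n])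
              (by linarith)
          have s4 := mul_le_mul_of_nonneg_left s1 (inv_pos.2 ha).le
          have s5 := mul_le_mul_of_nonneg_left s2 (inv_pos.2 hb).le
          linarith
        · rw [if_neg h2] at ih
          have hn : 1 ≤ n := by
            rcases Nat.eq_zero_or_pos n with rfl | h
            · simp at h2
            · exact h
          have t := rpow_neg_sub_one_le_telescope hb (by linarith) hn
          rw [show -(τ - 2) - 1 = -(τ - 1) by ring] at t
          linarith
  refine key.trans ?_
  split_ifs with h
  · have h1 := mul_le_mul_of_nonneg_left (hsmall n h) (inv_pos.2 ha).le
    have h2 : 0 < (τ - 2)⁻¹ * δ ^ (τ - 2) := by positivity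
    linarith
  · have : 0 ≤ (τ - 2)⁻¹ * (n : ℝ) ^ (-(τ - 2)) := by positivity
    linarith

/-- The increments of `min x (x²)` over steps of length `δ` are at most `2δ min x 1` at the right
endpoint, which prepares summation by parts. -/
theorem min_self_sq_le_sum {δ : ℝ} (hδ : 0 ≤ δ) (k : ℕ) :
    min (k * δ) ((k * δ) ^ 2) ≤ ∑ j ∈ Finset.range k, 2 * δ * min (((j : ℝ) + 1) * δ) 1 := by
  induction k with
  | zero => simp
  | succ k ih =>
    rw [Finset.sum_range_succ]
    push_cast
    have hk : 0 ≤ (k : ℝ) * δ := by positivity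
    set x := (k : ℝ) * δ with hx
    have e : ((k : ℝ) + 1) * δ = x + δ := by rw [hx]; ring
    rw [e]
    have h : min (x + δ) ((x + δ) ^ 2) ≤ min x (x ^ 2) + 2 * δ * min (x + δ) 1 := by
      rcases le_total (x + δ) 1 with h1 | h1
      · have h2 : x ^ 2 ≤ x := by nlinarith
        rw [min_eq_left h1, min_eq_right h2]
        refine (min_le_right _ _).trans ?_
        nlinarith
      · rw [min_eq_right h1]
        refine (min_le_left _ _).trans ?_
        rcases le_total x 1 with h2 | h2
        · have h3 : x ^ 2 ≤ x := by nlinarith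
          rw [min_eq_right h3]
          nlinarith
        · have h3 : x ≤ x ^ 2 := by nlinarith
          rw [min_eq_left h3]
          linarith
    linarith

/-- Summation by parts: exchanging the sums gives `g j` the weight `∑_{k > j} P k`, to which the
tail hypothesis applies at `j + 1`. -/
theorem sum_mul_sum_range_le {P : PMF ℕ} {τ c : ℝ}
    (h : ∀ k : ℕ, 1 ≤ k → ∑' i : ℕ, (P (k + i)).toReal ≤ c * (k : ℝ) ^ (-(τ - 1)))
    {g : ℕ → ℝ} (hg : ∀ j, 0 ≤ g j) (n : ℕ) :
    ∑ k ∈ Finset.range n, (P k).toReal * ∑ j ∈ Finset.range k, g j ≤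
      ∑ j ∈ Finset.range n, g j * (c * ((j : ℝ) + 1) ^ (-(τ - 1))) := by
  have hs : Summable fun k => (P k).toReal := ENNReal.summable_toReal P.tsum_coe_ne_top
  calc ∑ k ∈ Finset.range n, (P k).toReal * ∑ j ∈ Finset.range k, g j
      = ∑ k ∈ Finset.range n, ∑ j ∈ Finset.range n, if j < k then (P k).toReal * g j else 0 := by
        refine Finset.sum_congr rfl fun k hk => ?_
        rw [← Finset.sum_filter, Finset.mul_sum]
        refine Finset.sum_congr ?_ fun _ _ => rfl
        ext j
        simp only [Finset.mem_filter, Finset.mem_range] at hk ⊢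
        omega
    _ = ∑ j ∈ Finset.range n, ∑ k ∈ Finset.range n, if j < k then (P k).toReal * g j else 0 :=
        Finset.sum_comm
    _ ≤ _ := by
        refine Finset.sum_le_sum fun j _ => ?_
        have h1 := h (j + 1) (by omega)
        push_cast at h1
        refine le_trans ?_ (mul_le_mul_of_nonneg_left h1 (hg j))
        have hs' : Summable fun i => (P (j + 1 + i)).toReal :=
          hs.comp_injective (add_right_injective (j + 1))
        rw [← Finset.sum_filter, ← Finset.sum_mul, mul_comm]
        refine mul_le_mul_of_nonneg_left ?_ (hg j)
        have : (Finset.range n).filter (fun k => j < k) =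
            (Finset.range (n - (j + 1))).image (fun i => j + 1 + i) := by
          ext k
          simp only [Finset.mem_filter, Finset.mem_range, Finset.mem_image]
          constructor
          · intro hk
            exact ⟨k - (j + 1), by omega, by omega⟩
          · rintro ⟨i, hi, rfl⟩
            omega
        rw [this, Finset.sum_image (by intro a _ b _ hab; simpa using hab)]
        exact hs'.sum_le_tsum _ fun _ _ => ENNReal.toReal_nonneg

/-- The truncated second moment of a distribution with strongly finite mean. -/
theorem StronglyFiniteMean.exists_tsum_min_le {P : PMF ℕ} {τ : ℝ} (hτ₂ : 2 < τ) (hτ₃ : τ < 3)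
    (hP : StronglyFiniteMean P τ) : ∃ C : ℝ, 0 ≤ C ∧ ∀ δ : ℝ, 0 < δ →
      Summable (fun k : ℕ => (P k).toReal * min (k * δ) ((k * δ) ^ 2)) ∧
      ∑' k : ℕ, (P k).toReal * min (k * δ) ((k * δ) ^ 2) ≤ C * δ ^ (τ - 1) := by
  obtain ⟨c, hc, h⟩ := hP
  have ha : 0 < 3 - τ := by linarith
  have hb : 0 < τ - 2 := by linarith
  refine ⟨2 * c * ((3 - τ)⁻¹ + 1 + (τ - 2)⁻¹), by positivity, fun δ hδ => ?_⟩
  have hnn : ∀ k : ℕ, 0 ≤ (P k).toReal * min (k * δ) ((k * δ) ^ 2) := fun k => by positivity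
  have hle : ∀ n, ∑ k ∈ Finset.range n, (P k).toReal * min (k * δ) ((k * δ) ^ 2) ≤
      2 * c * ((3 - τ)⁻¹ + 1 + (τ - 2)⁻¹) * δ ^ (τ - 1) := by
    intro n
    calc ∑ k ∈ Finset.range n, (P k).toReal * min (k * δ) ((k * δ) ^ 2)
        ≤ ∑ k ∈ Finset.range n, (P k).toReal *
            ∑ j ∈ Finset.range k, 2 * δ * min (((j : ℝ) + 1) * δ) 1 :=
          Finset.sum_le_sum fun k _ => mul_le_mul_of_nonneg_left (min_self_sq_le_sum hδ.le k)
            ENNReal.toReal_nonneg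
      _ ≤ ∑ j ∈ Finset.range n, 2 * δ * min (((j : ℝ) + 1) * δ) 1 *
            (c * ((j : ℝ) + 1) ^ (-(τ - 1))) :=
          sum_mul_sum_range_le h (fun j => by positivity) n
      _ = 2 * c * δ * ∑ j ∈ Finset.range n,
            min (((j : ℝ) + 1) * δ) 1 * ((j : ℝ) + 1) ^ (-(τ - 1)) := by
          rw [Finset.mul_sum]
          exact Finset.sum_congr rfl fun j _ => by ring
      _ ≤ 2 * c * δ * (((3 - τ)⁻¹ + 1 + (τ - 2)⁻¹) * δ ^ (τ - 2)) :=
          mul_le_mul_of_nonneg_left (sum_min_mul_rpow_le hτ₂ hτ₃ hδ n) (by positivity)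
      _ = _ := by
          rw [show τ - 1 = 1 + (τ - 2) by ring, Real.rpow_add hδ, Real.rpow_one]
          ring
  exact ⟨summable_of_sum_range_le hnn hle, Real.tsum_le_of_sum_range_le hnn hle⟩

/-! ### Exchangeability, size-biasing and the first-order term -/

section Exchange

variable {α : Type*} [MeasurableSpace α] {π : Measure α} [IsProbabilityMeasure π]

/-- In an i.i.d. sequence, the pair formed by one of the first `n + 1` terms and the sum over the
others consists of a sample and an independent sum over `n` samples. -/
theorem infinitePi_map_eval_sum_erase {f : α → ℝ} (hf : Measurable f) {m n : ℕ} (hm : m < n + 1) :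
    (Measure.infinitePi fun _ : ℕ => π).map
      (fun ω => (ω m, ∑ j ∈ (Finset.range (n + 1)).erase m, f (ω j))) =
    π.prod ((Measure.infinitePi fun _ : ℕ => π).map (fun ω => ∑ j ∈ Finset.range n, f (ω j))) := by
  set Q := Measure.infinitePi fun _ : ℕ => π with hQ
  have hind := (ProbabilityTheory.iIndepFun_infinitePi (P := fun _ : ℕ => π)
    (X := fun _ a => a) (fun _ => measurable_id)).indepFun_finset {m}
      ((Finset.range (n + 1)).erase m) (by simp) (fun i => measurable_pi_apply i)
  have hφ : Measurable fun a : (({m} : Finset ℕ) → α) => a ⟨m, Finset.mem_singleton_self m⟩ :=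
    measurable_pi_apply _
  have hψ : Measurable fun a : (((Finset.range (n + 1)).erase m : Finset ℕ) → α) =>
      ∑ j, f (a j) := by fun_prop
  have hind' := hind.comp hφ hψ
  have e : ((fun a : ((Finset.range (n + 1)).erase m : Finset ℕ) → α => ∑ j, f (a j)) ∘
      fun (ω : ℕ → α) (i : ((Finset.range (n + 1)).erase m : Finset ℕ)) => ω i) =
      fun ω => ∑ j ∈ (Finset.range (n + 1)).erase m, f (ω j) := by
    funext ω
    exact Finset.sum_coe_sort ((Finset.range (n + 1)).erase m) (fun j => f (ω j))
  rw [e] at hind'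
  have hprod := (ProbabilityTheory.indepFun_iff_map_prod_eq_prod_map_map
    (hφ.comp (by fun_prop)).aemeasurable (e ▸ hψ.comp (by fun_prop)).aemeasurable).1 hind'
  have h1 : Q.map ((fun a : (({m} : Finset ℕ) → α) => a ⟨m, Finset.mem_singleton_self m⟩) ∘
      fun (ω : ℕ → α) (i : ({m} : Finset ℕ)) => ω i) = π :=
    Measure.infinitePi_map_eval (fun _ : ℕ => π) m
  have h2 : Q.map (fun ω => ∑ j ∈ (Finset.range (n + 1)).erase m, f (ω j)) =
      Q.map (fun ω => ∑ j ∈ Finset.range n, f (ω j)) := by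
    -- The increasing enumeration of the indices other than `m`; an injective reindexing preserves
    -- the i.i.d. law.
    set g : ℕ → ℕ := fun j => if j < m then j else j + 1 with hg
    have hginj : Function.Injective g := by
      intro a b hab
      simp only [hg] at hab
      split_ifs at hab <;> omega
    have hs : (Finset.range (n + 1)).erase m = (Finset.range n).image g := by
      ext j
      simp only [Finset.mem_erase, Finset.mem_range, Finset.mem_image, hg]
      constructor
      · rintro ⟨h1, h2⟩
        by_cases h3 : j < m
        · exact ⟨j, by omega, by simp [h3]⟩
        · refine ⟨j - 1, by omega, ?_⟩
          rw [if_neg (by omega)]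
          omega
      · rintro ⟨a, ha, rfl⟩
        split_ifs <;> omega
    have hmap := Measure.map_infinitePi_infinitePi_of_inj (P := fun _ : ℕ => π) hginj
    conv_rhs => rw [hQ, ← hmap, Measure.map_map (by fun_prop) (by fun_prop)]
    congr 1
    funext ω
    rw [hs, Finset.sum_image fun a _ b _ hab => hginj hab]
    rfl
  rw [h1, h2] at hprod
  exact hprod

theorem integral_eval_sum_erase {f : α → ℝ} (hf : Measurable f) {m n : ℕ} (hm : m < n + 1)
    {F : α → ℝ → ℝ} (hF : Measurable (Function.uncurry F)) (B : ℝ)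
    (hint : Integrable (fun x : α × ℝ => F x.1 (B + x.2)) (π.prod
      ((Measure.infinitePi fun _ : ℕ => π).map (fun ω => ∑ j ∈ Finset.range n, f (ω j))))) :
    ∫ ω, F (ω m) (B + ∑ j ∈ (Finset.range (n + 1)).erase m, f (ω j))
      ∂(Measure.infinitePi fun _ : ℕ => π) =
    ∫ ω, (∫ a, F a (B + ∑ j ∈ Finset.range n, f (ω j)) ∂π)
      ∂(Measure.infinitePi fun _ : ℕ => π) := by
  have hF' : Measurable fun x : α × ℝ => F x.1 (B + x.2) :=
    hF.comp (measurable_fst.prodMk (measurable_snd.const_add B))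
  have hsum : Measurable fun ω : ℕ → α => ∑ j ∈ Finset.range n, f (ω j) := by fun_prop
  have h1 := integral_map (μ := Measure.infinitePi fun _ : ℕ => π)
    (φ := fun ω => (ω m, ∑ j ∈ (Finset.range (n + 1)).erase m, f (ω j)))
    (by fun_prop) (f := fun x : α × ℝ => F x.1 (B + x.2)) hF'.aestronglyMeasurable
  rw [← h1, infinitePi_map_eval_sum_erase hf hm, integral_prod_symm _ hint,
    integral_map hsum.aemeasurable]
  exact (hF'.stronglyMeasurable.integral_prod_left').aestronglyMeasurable

end Exchange

theorem sizeBiasedWeight_nonneg (P : PMF ℕ) (k : ℕ) : 0 ≤ sizeBiasedWeight P k := by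
  have : 0 ≤ degMean P := tsum_nonneg fun k => by positivity
  unfold sizeBiasedWeight
  positivity

theorem integral_sizeBiased (P : PMF ℕ) (f : ℕ → ℝ) :
    ∫ k, f k ∂(sizeBiased P) = ∑' k, sizeBiasedWeight P k * f k := by
  rw [sizeBiased, integral_sum_dirac fun k => ENNReal.ofReal_ne_top]
  simp only [ENNReal.toReal_ofReal (sizeBiasedWeight_nonneg P _), smul_eq_mul]

/-- If the mean were zero, division by zero would make every size-biased weight vanish, and the
recursion would produce the zero measure. Existence of a fixed point thus supplies the positivity of
the mean. -/
theorem IsTreeFixedPoint.degMean_ne_zero {P : PMF ℕ} {β B : ℝ} {ν : Measure ℝ}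
    (h : IsTreeFixedPoint P β B ν) : degMean P ≠ 0 := by
  intro h0
  have hp := h.isProbabilityMeasure
  have hz : sizeBiased P = 0 := by
    rw [sizeBiased, Measure.sum_eq_zero]
    simp [sizeBiasedWeight, h0]
  have hf := h.fixed
  rw [treeRecursion, hz, Measure.zero_prod, Measure.map_zero] at hf
  exact IsProbabilityMeasure.ne_zero ν hf.symm

/-- The first-order effect, on `log (1 + tanh β tanh h₁ tanh h)`, of changing `h₁` from `p.1` to
`p.2`. -/
def messageGrad (β : ℝ) (p : ℝ × ℝ) (h : ℝ) : ℝ :=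
  (Real.tanh β * Real.tanh p.2 - Real.tanh β * Real.tanh p.1) *
    (Real.tanh h / (1 + Real.tanh β * Real.tanh p.1 * Real.tanh h))

theorem measurable_messageGrad (β : ℝ) : Measurable (Function.uncurry (messageGrad β)) := by
  have := continuous_tanh'.measurable
  unfold Function.uncurry messageGrad
  fun_prop

theorem measurable_messageGrad_comp {α : Type*} [MeasurableSpace α] {β : ℝ} {f : α → ℝ × ℝ}
    {g : α → ℝ} (hf : Measurable f) (hg : Measurable g) :
    Measurable fun a => messageGrad β (f a) (g a) := by
  have h := Measurable.comp (measurable_messageGrad β) (hf.prodMk hg)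
  simpa only [Function.comp_def, Function.uncurry_apply_pair] using h

theorem measurable_message (β : ℝ) : Measurable (message β) := by
  have := continuous_tanh'.measurable
  unfold message Real.artanh
  fun_prop

theorem tanh_mul_tanh_mem {β h : ℝ} (hβ : 0 ≤ β) (hh : 0 ≤ h) :
    Real.tanh β * Real.tanh h ∈ Set.Ico (0 : ℝ) 1 :=
  ⟨mul_nonneg (tanh_nonneg' hβ) (tanh_nonneg' hh),
    mul_lt_one_of_nonneg_of_lt_one_left (tanh_nonneg' hβ) (Real.tanh_lt_one _)
      (Real.tanh_lt_one _).le⟩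

theorem abs_tanh_mul_sub_le {β x y δ : ℝ} (hβ : 0 ≤ β) (h : |Real.tanh y - Real.tanh x| ≤ δ) :
    |Real.tanh β * Real.tanh y - Real.tanh β * Real.tanh x| ≤ δ := by
  rw [← mul_sub, abs_mul, abs_of_nonneg (tanh_nonneg' hβ)]
  exact (mul_le_of_le_one_left (abs_nonneg _) (Real.tanh_lt_one β).le).trans h

theorem abs_messageGrad_le {β δ h : ℝ} {p : ℝ × ℝ} (hβ : 0 ≤ β) (hp : 0 ≤ p.1) (hh : 0 ≤ h)
    (hd : |Real.tanh p.2 - Real.tanh p.1| ≤ δ) : |messageGrad β p h| ≤ δ :=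
  (abs_mul_div_one_add_mul_le (tanh_mul_tanh_mem hβ hp).1 (tanh_nonneg' hh)
    (Real.tanh_lt_one h).le).trans (abs_tanh_mul_sub_le hβ hd)

section Pressure

variable {P : PMF ℕ} {β B δ : ℝ} {ν₁ ν₂ : Measure ℝ} {π : Measure (ℝ × ℝ)}

theorem integrable_messageGrad [IsProbabilityMeasure π] {μ : Measure ℝ} [IsProbabilityMeasure μ]
    (hβ : 0 ≤ β) (hπ : ∀ᵐ p ∂π, 0 ≤ p.1) (hd : ∀ᵐ p ∂π, |Real.tanh p.2 - Real.tanh p.1| ≤ δ)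
    (hμ : ∀ᵐ h ∂μ, 0 ≤ h) :
    Integrable (fun x : (ℝ × ℝ) × ℝ => messageGrad β x.1 x.2) (π.prod μ) := by
  refine Integrable.of_bound (measurable_messageGrad β).aestronglyMeasurable δ ?_
  have h1 := (Measure.quasiMeasurePreserving_fst (μ := π) (ν := μ)).ae (hπ.and hd)
  have h2 := (Measure.quasiMeasurePreserving_snd (μ := π) (ν := μ)).ae hμ
  filter_upwards [h1, h2] with x hx hx'
  exact abs_messageGrad_le hβ hx.1 hx' hx.2

theorem measurable_vertexGrad (β B : ℝ) : Measurable fun x : ℕ × (ℕ → ℝ × ℝ) =>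
    vertexGrad B x.1 (fun i => Real.tanh β * Real.tanh (x.2 i).1)
      (fun i => Real.tanh β * Real.tanh (x.2 i).2) := by
  apply measurable_from_prod_countable_right
  intro k
  have := continuous_tanh'.measurable
  simp only [vertexGrad, cavityMag, Real.artanh]
  fun_prop

/-- Mean first-order change of the vertex term at a vertex of degree `n + 1`. -/
theorem integral_vertexGrad_succ [IsProbabilityMeasure π] (hβ : 0 ≤ β) (hB : 0 ≤ B)
    (hπ : ∀ᵐ p ∂π, 0 ≤ p.1) (hd : ∀ᵐ p ∂π, |Real.tanh p.2 - Real.tanh p.1| ≤ δ) (n : ℕ) :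
    ∫ ω, vertexGrad B (n + 1) (fun i => Real.tanh β * Real.tanh (ω i).1)
        (fun i => Real.tanh β * Real.tanh (ω i).2) ∂(Measure.infinitePi fun _ : ℕ => π) =
      (n + 1) * ∫ ω, (∫ p, messageGrad β p (treeStep β B (n, fun i => (ω i).1)) ∂π)
        ∂(Measure.infinitePi fun _ : ℕ => π) := by
  have hf : Measurable fun p : ℝ × ℝ => message β p.1 :=
    (measurable_message β).comp measurable_fst
  have hae := ae_forall_infinitePi (hπ.and hd)
  have e : ∀ ω : ℕ → ℝ × ℝ, vertexGrad B (n + 1) (fun i => Real.tanh β * Real.tanh (ω i).1)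
      (fun i => Real.tanh β * Real.tanh (ω i).2) = ∑ m ∈ Finset.range (n + 1),
        messageGrad β (ω m) (B + ∑ j ∈ (Finset.range (n + 1)).erase m, message β (ω j).1) :=
    fun ω => rfl
  simp only [e]
  rw [integral_finsetSum]
  · rw [Finset.sum_congr rfl fun m hm => integral_eval_sum_erase hf (Finset.mem_range.1 hm)
      (measurable_messageGrad β) B ?_]
    · simp [treeStep_eq]
    · set S : Measure ℝ := (Measure.infinitePi fun _ : ℕ => π).map
        (fun ω => ∑ j ∈ Finset.range n, message β (ω j).1) with hS
      have hSm : Measurable fun ω : ℕ → ℝ × ℝ => ∑ j ∈ Finset.range n, message β (ω j).1 :=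
        Finset.measurable_fun_sum _ fun j _ => hf.comp (measurable_pi_apply j)
      have : IsProbabilityMeasure S := Measure.isProbabilityMeasure_map hSm.aemeasurable
      have hS0 : ∀ᵐ h ∂S, 0 ≤ h := by
        rw [hS, ae_map_iff hSm.aemeasurable measurableSet_Ici]
        filter_upwards [hae] with ω hω
        exact Finset.sum_nonneg fun i _ => message_nonneg hβ (hω i).1
      refine Integrable.of_bound ((measurable_messageGrad β).comp
        (measurable_fst.prodMk (measurable_snd.const_add B))).aestronglyMeasurable δ ?_
      have h1 := (Measure.quasiMeasurePreserving_fst (μ := π) (ν := S)).ae (hπ.and hd)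
      have h2 := (Measure.quasiMeasurePreserving_snd (μ := π) (ν := S)).ae hS0
      filter_upwards [h1, h2] with x hx hx'
      exact abs_messageGrad_le hβ hx.1 (add_nonneg hB hx') hx.2
  · intro m _
    have hm : Measurable fun ω : ℕ → ℝ × ℝ => messageGrad β (ω m)
        (B + ∑ j ∈ (Finset.range (n + 1)).erase m, message β (ω j).1) := by
      have hs : Measurable fun ω : ℕ → ℝ × ℝ =>
          ∑ j ∈ (Finset.range (n + 1)).erase m, message β (ω j).1 :=
        Finset.measurable_fun_sum _ fun j _ => hf.comp (measurable_pi_apply j)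
      exact measurable_messageGrad_comp (measurable_pi_apply m) (hs.const_add B)
    refine Integrable.of_bound hm.aestronglyMeasurable δ ?_
    filter_upwards [hae] with ω hω
    exact abs_messageGrad_le hβ (hω m).1
      (add_nonneg hB (Finset.sum_nonneg fun i _ => message_nonneg hβ (hω i).1)) (hω m).2

/-- The fixed-point equation enters here: `ν₁` is rewritten as the law of one recursion step, and
the factor `degMean P` cancels the normalization of the size-biased weights. -/
theorem integral_messageGrad_eq_tsum (hβ : 0 ≤ β) (hB : 0 ≤ B)
    (h₁ : IsTreeFixedPoint P β B ν₁) (hπ : IsCoupling π ν₁ ν₂)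
    (hs : Summable fun k : ℕ => (k : ℝ) * (P k).toReal)
    (hd : ∀ᵐ p ∂π, |Real.tanh p.2 - Real.tanh p.1| ≤ δ) :
    degMean P * ∫ h, (∫ p, messageGrad β p h ∂π) ∂ν₁ =
      ∑' n : ℕ, ((n : ℝ) + 1) * (P (n + 1)).toReal *
        ∫ ω, (∫ p, messageGrad β p (treeStep β B (n, fun i => (ω i).1)) ∂π)
          ∂(Measure.infinitePi fun _ : ℕ => π) := by
  have := hπ.isProbabilityMeasure
  have hpos := h₁.degMean_ne_zero
  have hP0 : P 0 ≠ 1 := by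
    intro h0
    apply hpos
    have hsupp : P.support = {0} := P.apply_eq_one_iff 0 |>.1 h0
    have : ∀ k : ℕ, (k : ℝ) * (P k).toReal = 0 := by
      intro k
      rcases Nat.eq_zero_or_pos k with rfl | hk
      · simp
      · have : k ∉ P.support := by
          rw [hsupp, Set.mem_singleton_iff]
          omega
        rw [PMF.mem_support_iff, not_not] at this
        simp [this]
    rw [degMean, tsum_congr this, tsum_zero]
  have := isProbabilityMeasure_sizeBiased hs hP0
  have hmG : StronglyMeasurable fun h => ∫ p, messageGrad β p h ∂π :=
    (measurable_messageGrad β).stronglyMeasurable.integral_prod_left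
  have hπ0 := hπ.ae_fst h₁.nonneg
  have hmT : Measurable fun x : ℕ × (ℕ → ℝ × ℝ) => treeStep β B (x.1, fun i => (x.2 i).1) :=
    (measurable_treeStep β B).comp (by fun_prop)
  have e : ν₁ = ((sizeBiased P).prod (Measure.infinitePi fun _ : ℕ => π)).map
      (fun x => treeStep β B (x.1, fun i => (x.2 i).1)) := by
    conv_lhs => rw [← h₁.fixed, treeRecursion, ← hπ.prod_map_fst,
      Measure.map_map (measurable_treeStep _ _) (by fun_prop)]
    rfl
  have hbound : ∀ h, 0 ≤ h → ‖∫ p, messageGrad β p h ∂π‖ ≤ δ := by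
    intro h hh
    refine (norm_integral_le_of_norm_le_const (C := δ) ?_).trans (by simp)
    filter_upwards [hπ0, hd] with p hp hp'
    exact abs_messageGrad_le hβ hp hh hp'
  have hint : Integrable (fun x : ℕ × (ℕ → ℝ × ℝ) =>
      ∫ p, messageGrad β p (treeStep β B (x.1, fun i => (x.2 i).1)) ∂π)
      ((sizeBiased P).prod (Measure.infinitePi fun _ : ℕ => π)) := by
    refine Integrable.of_bound (hmG.measurable.comp hmT).aestronglyMeasurable δ ?_
    have h2 := (Measure.quasiMeasurePreserving_snd (μ := sizeBiased P)).ae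
      (ae_forall_infinitePi hπ0)
    filter_upwards [h2] with x hx
    refine hbound _ ?_
    rw [treeStep_eq]
    exact add_nonneg hB (Finset.sum_nonneg fun i _ => message_nonneg hβ (hx i))
  conv_lhs => rw [e, integral_map hmT.aemeasurable hmG.aestronglyMeasurable, integral_prod _ hint,
    integral_sizeBiased, ← tsum_mul_left]
  refine tsum_congr fun n => ?_
  rw [sizeBiasedWeight]
  field_simp

theorem integrable_natCast (hs : Summable fun k : ℕ => (k : ℝ) * (P k).toReal) :
    Integrable (fun k : ℕ => (k : ℝ)) P.toMeasure := by
  rw [← Measure.sum_smul_dirac P.toMeasure]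
  refine integrable_sum_dirac (fun k => measure_ne_top _ _) (hs.congr fun k => ?_)
  rw [P.toMeasure_apply_singleton k (MeasurableSet.singleton k),
    Real.norm_of_nonneg (Nat.cast_nonneg k), mul_comm]

theorem integrable_vertexGrad [IsProbabilityMeasure π] (hβ : 0 ≤ β) (hB : 0 ≤ B)
    (hs : Summable fun k : ℕ => (k : ℝ) * (P k).toReal) (hπ : ∀ᵐ p ∂π, 0 ≤ p.1)
    (hd : ∀ᵐ p ∂π, |Real.tanh p.2 - Real.tanh p.1| ≤ δ) :
    Integrable (fun x : ℕ × (ℕ → ℝ × ℝ) =>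
      vertexGrad B x.1 (fun i => Real.tanh β * Real.tanh (x.2 i).1)
        (fun i => Real.tanh β * Real.tanh (x.2 i).2))
      (P.toMeasure.prod (Measure.infinitePi fun _ : ℕ => π)) := by
  refine (((integrable_natCast hs).mul_const δ).comp_fst
    (Measure.infinitePi fun _ : ℕ => π)).mono' (measurable_vertexGrad β B).aestronglyMeasurable ?_
  have h2 := (Measure.quasiMeasurePreserving_snd (μ := P.toMeasure)).ae
    (ae_forall_infinitePi (hπ.and hd))
  filter_upwards [h2] with x hx
  exact abs_vertexGrad_le hB (fun i => tanh_mul_tanh_mem hβ (hx i).1)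
    (fun i => abs_tanh_mul_sub_le hβ (hx i).2) x.1

/-- Degree `n + 1` contributes `(n + 1) P (n + 1)` times the mean effect of one message against a
cavity field with `n` others, and degree `0` contributes nothing. This is the series obtained from
the fixed-point equation. -/
theorem integral_vertexGrad (hβ : 0 ≤ β) (hB : 0 ≤ B)
    (h₁ : IsTreeFixedPoint P β B ν₁) (hπ : IsCoupling π ν₁ ν₂)
    (hs : Summable fun k : ℕ => (k : ℝ) * (P k).toReal)
    (hd : ∀ᵐ p ∂π, |Real.tanh p.2 - Real.tanh p.1| ≤ δ) :
    ∫ x, vertexGrad B x.1 (fun i => Real.tanh β * Real.tanh (x.2 i).1)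
        (fun i => Real.tanh β * Real.tanh (x.2 i).2)
        ∂(P.toMeasure.prod (Measure.infinitePi fun _ : ℕ => π)) =
      degMean P * ∫ h, (∫ p, messageGrad β p h ∂π) ∂ν₁ := by
  have := hπ.isProbabilityMeasure
  have hπ0 := hπ.ae_fst h₁.nonneg
  have hint := integrable_vertexGrad hβ hB hs hπ0 hd
  have hint' := hint.integral_prod_left
  have hsum : Summable fun k : ℕ => (P k).toReal •
      ∫ ω, vertexGrad B k (fun i => Real.tanh β * Real.tanh (ω i).1)
        (fun i => Real.tanh β * Real.tanh (ω i).2) ∂(Measure.infinitePi fun _ : ℕ => π) := by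
    refine Summable.of_norm ?_
    rw [← Measure.sum_smul_dirac P.toMeasure] at hint'
    refine hint'.summable_of_dirac.congr fun k => ?_
    rw [P.toMeasure_apply_singleton k (MeasurableSet.singleton k), norm_smul,
      Real.norm_of_nonneg ENNReal.toReal_nonneg]
  rw [integral_prod _ hint, PMF.integral_eq_tsum _ _ hint', hsum.tsum_eq_zero_add,
    integral_messageGrad_eq_tsum hβ hB h₁ hπ hs hd]
  have h0 : ∀ u v, vertexGrad B 0 u v = 0 := fun u v => by simp [vertexGrad]
  simp only [h0, integral_zero, mul_zero, zero_add, smul_eq_mul]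
  refine tsum_congr fun n => ?_
  rw [integral_vertexGrad_succ hβ hB hπ0 hd]
  ring

end Pressure

/-! ### Stationarity of the pressure at a fixed point -/

section PressureDifference

variable {P : PMF ℕ} {β B δ : ℝ} {ν₁ ν₂ : Measure ℝ} {π : Measure (ℝ × ℝ)}

/-- The change of the vertex expectation, up to its first-order part. -/
theorem abs_integral_vertexTerm_sub_le (hβ : 0 ≤ β) (hB : 0 ≤ B)
    (h₁ : IsTreeFixedPoint P β B ν₁) (hν₂ : ∀ᵐ h ∂ν₂, 0 ≤ h) (hπ : IsCoupling π ν₁ ν₂)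
    (hs : Summable fun k : ℕ => (k : ℝ) * (P k).toReal)
    (hd : ∀ᵐ p ∂π, |Real.tanh p.2 - Real.tanh p.1| ≤ δ)
    (hsum : Summable fun k : ℕ => (P k).toReal * min (k * δ) ((k * δ) ^ 2)) (hδ : 0 ≤ δ) :
    |∫ x, vertexTerm β B x ∂(P.toMeasure.prod (iidLaw ν₂)) -
        ∫ x, vertexTerm β B x ∂(P.toMeasure.prod (iidLaw ν₁)) -
        degMean P * ∫ h, (∫ p, messageGrad β p h ∂π) ∂ν₁| ≤
      3 * ∑' k : ℕ, (P k).toReal * min (k * δ) ((k * δ) ^ 2) := by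
  have := hπ.isProbabilityMeasure
  have := h₁.isProbabilityMeasure
  have : IsProbabilityMeasure ν₂ := by
    rw [← hπ.map_snd]
    exact Measure.isProbabilityMeasure_map measurable_snd.aemeasurable
  have hπ1 := hπ.ae_fst h₁.nonneg
  have hπ2 := hπ.ae_snd hν₂
  have hm1 : Measurable fun x : ℕ × (ℕ → ℝ × ℝ) => (x.1, fun i => (x.2 i).1) := by fun_prop
  have hm2 : Measurable fun x : ℕ × (ℕ → ℝ × ℝ) => (x.1, fun i => (x.2 i).2) := by fun_prop
  have i1 := integrable_vertexTerm hs hβ hB h₁.nonneg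
  have i2 := integrable_vertexTerm hs hβ hB hν₂
  rw [← hπ.prod_map_fst] at i1
  rw [← hπ.prod_map_snd] at i2
  have i1' : Integrable (fun x : ℕ × (ℕ → ℝ × ℝ) => vertexTerm β B (x.1, fun i => (x.2 i).1)) _ :=
    i1.comp_measurable hm1
  have i2' : Integrable (fun x : ℕ × (ℕ → ℝ × ℝ) => vertexTerm β B (x.1, fun i => (x.2 i).2)) _ :=
    i2.comp_measurable hm2
  have i4 : Integrable (fun x : ℕ × (ℕ → ℝ × ℝ) => vertexTerm β B (x.1, fun i => (x.2 i).2) -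
      vertexTerm β B (x.1, fun i => (x.2 i).1)) _ := i2'.sub i1'
  have i3 := integrable_vertexGrad hβ hB hs hπ1 hd
  rw [← integral_vertexGrad hβ hB h₁ hπ hs hd, ← hπ.prod_map_fst, ← hπ.prod_map_snd,
    integral_map hm1.aemeasurable (measurable_vertexTerm β B).aestronglyMeasurable,
    integral_map hm2.aemeasurable (measurable_vertexTerm β B).aestronglyMeasurable,
    ← integral_sub i2' i1', ← integral_sub i4 i3, ← Real.norm_eq_abs]
  have hmin : Integrable (fun k : ℕ => min (k * δ) ((k * δ) ^ 2)) P.toMeasure := by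
    rw [← Measure.sum_smul_dirac P.toMeasure]
    refine integrable_sum_dirac (fun k => measure_ne_top _ _) (hsum.congr fun k => ?_)
    rw [P.toMeasure_apply_singleton k (MeasurableSet.singleton k),
      Real.norm_of_nonneg (by positivity)]
  have hmin' : Integrable (fun x : ℕ × (ℕ → ℝ × ℝ) => 3 * min (x.1 * δ) ((x.1 * δ) ^ 2))
      (P.toMeasure.prod (Measure.infinitePi fun _ : ℕ => π)) :=
    (hmin.comp_fst (Measure.infinitePi fun _ : ℕ => π)).const_mul 3
  have e : ∫ x : ℕ × (ℕ → ℝ × ℝ), 3 * min (x.1 * δ) ((x.1 * δ) ^ 2)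
      ∂(P.toMeasure.prod (Measure.infinitePi fun _ : ℕ => π)) =
      3 * ∑' k : ℕ, (P k).toReal * min (k * δ) ((k * δ) ^ 2) := by
    rw [integral_const_mul, integral_fun_fst (fun k : ℕ => min (k * δ) ((k * δ) ^ 2)),
      PMF.integral_eq_tsum _ _ hmin]
    simp
  rw [← e]
  refine norm_integral_le_of_norm_le hmin' ?_
  have h2 := (Measure.quasiMeasurePreserving_snd (μ := P.toMeasure)).ae
    (ae_forall_infinitePi (hπ1.and (hπ2.and hd)))
  filter_upwards [h2] with x hx
  exact abs_vertex_remainder_le hB (fun i => tanh_mul_tanh_mem hβ (hx i).1)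
    (fun i => tanh_mul_tanh_mem hβ (hx i).2.1) (fun i => abs_tanh_mul_sub_le hβ (hx i).2.2) x.1

/-- Move the first end with the second at `q.2`, then the second with the first at `p.1`. The errors
are `3δ²`, where one `δ²` comes from evaluating the gradient at `q.1`, and `2δ²`. -/
theorem abs_edgeTerm_sub_le {p q : ℝ × ℝ} (hβ : 0 ≤ β) (hp₁ : 0 ≤ p.1) (hp₂ : 0 ≤ p.2)
    (hq₁ : 0 ≤ q.1) (hq₂ : 0 ≤ q.2) (hp : |Real.tanh p.2 - Real.tanh p.1| ≤ δ)
    (hq : |Real.tanh q.2 - Real.tanh q.1| ≤ δ) :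
    |edgeTerm β (p.2, q.2) - edgeTerm β (p.1, q.1) -
      (messageGrad β p q.1 + messageGrad β q p.1)| ≤ 5 * δ ^ 2 := by
  have hδ : 0 ≤ δ := (abs_nonneg _).trans hp
  obtain ⟨a1, a2⟩ := tanh_mul_tanh_mem hβ hp₁
  obtain ⟨b1, -⟩ := tanh_mul_tanh_mem hβ hp₂
  obtain ⟨c1, c2⟩ := tanh_mul_tanh_mem hβ hq₁
  obtain ⟨d1, -⟩ := tanh_mul_tanh_mem hβ hq₂
  have r1 := abs_log_one_add_mul_remainder_le a1 a2.le b1 (tanh_nonneg' hq₂)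
    (Real.tanh_lt_one q.2).le (tanh_nonneg' hq₁)
  have r2 := abs_log_one_add_mul_remainder_le c1 c2.le d1 (tanh_nonneg' hp₁)
    (Real.tanh_lt_one p.1).le (tanh_nonneg' hp₁)
  rw [sub_self, abs_zero, add_zero] at r2
  have s1 := abs_tanh_mul_sub_le hβ hp
  have s2 := abs_tanh_mul_sub_le hβ hq
  have t1 : |Real.tanh β * Real.tanh p.2 - Real.tanh β * Real.tanh p.1| *
      (2 * |Real.tanh β * Real.tanh p.2 - Real.tanh β * Real.tanh p.1| +
        |Real.tanh q.2 - Real.tanh q.1|) ≤ δ * (2 * δ + δ) :=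
    mul_le_mul s1 (by linarith) (by positivity) hδ
  have t2 : |Real.tanh β * Real.tanh q.2 - Real.tanh β * Real.tanh q.1| *
      (2 * |Real.tanh β * Real.tanh q.2 - Real.tanh β * Real.tanh q.1|) ≤ δ * (2 * δ) :=
    mul_le_mul s2 (by linarith) (by positivity) hδ
  have e : edgeTerm β (p.2, q.2) - edgeTerm β (p.1, q.1) -
      (messageGrad β p q.1 + messageGrad β q p.1) =
      (Real.log (1 + Real.tanh β * Real.tanh p.2 * Real.tanh q.2) -
        Real.log (1 + Real.tanh β * Real.tanh p.1 * Real.tanh q.2) - messageGrad β p q.1) +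
      (Real.log (1 + Real.tanh β * Real.tanh q.2 * Real.tanh p.1) -
        Real.log (1 + Real.tanh β * Real.tanh q.1 * Real.tanh p.1) - messageGrad β q p.1) := by
    simp only [edgeTerm]
    rw [mul_right_comm (Real.tanh β) (Real.tanh p.1) (Real.tanh q.2),
      mul_right_comm (Real.tanh β) (Real.tanh p.1) (Real.tanh q.1)]
    ring
  rw [e]
  refine (abs_add_le _ _).trans ((add_le_add (r1.trans t1) (r2.trans t2)).trans (le_of_eq ?_))
  ring

/-- The change of the edge expectation, up to its first-order part. -/
theorem abs_integral_edgeTerm_sub_le (hβ : 0 ≤ β) (hν₁ : ∀ᵐ h ∂ν₁, 0 ≤ h)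
    (hν₂ : ∀ᵐ h ∂ν₂, 0 ≤ h) (hπ : IsCoupling π ν₁ ν₂)
    (hd : ∀ᵐ p ∂π, |Real.tanh p.2 - Real.tanh p.1| ≤ δ) :
    |∫ h, edgeTerm β h ∂(ν₂.prod ν₂) - ∫ h, edgeTerm β h ∂(ν₁.prod ν₁) -
        2 * ∫ h, (∫ p, messageGrad β p h ∂π) ∂ν₁| ≤ 5 * δ ^ 2 := by
  have := hπ.isProbabilityMeasure
  have : IsProbabilityMeasure ν₁ := by
    rw [← hπ.map_fst]
    exact Measure.isProbabilityMeasure_map measurable_fst.aemeasurable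
  have : IsProbabilityMeasure ν₂ := by
    rw [← hπ.map_snd]
    exact Measure.isProbabilityMeasure_map measurable_snd.aemeasurable
  have hπ1 := hπ.ae_fst hν₁
  have hπ2 := hπ.ae_snd hν₂
  have m1 : (π.prod π).map (Prod.map Prod.fst Prod.fst) = ν₁.prod ν₁ := by
    rw [← Measure.map_prod_map _ _ measurable_fst measurable_fst, hπ.map_fst]
  have m2 : (π.prod π).map (Prod.map Prod.snd Prod.snd) = ν₂.prod ν₂ := by
    rw [← Measure.map_prod_map _ _ measurable_snd measurable_snd, hπ.map_snd]
  have m3 : (π.prod π).map (Prod.map id Prod.fst) = π.prod ν₁ := by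
    rw [← Measure.map_prod_map _ _ measurable_id measurable_fst, hπ.map_fst, Measure.map_id]
  have q1 : Measurable (Prod.map Prod.fst Prod.fst : (ℝ × ℝ) × (ℝ × ℝ) → ℝ × ℝ) := by fun_prop
  have q2 : Measurable (Prod.map Prod.snd Prod.snd : (ℝ × ℝ) × (ℝ × ℝ) → ℝ × ℝ) := by fun_prop
  have q3 : Measurable (Prod.map id Prod.fst : (ℝ × ℝ) × (ℝ × ℝ) → (ℝ × ℝ) × ℝ) := by fun_prop
  have i1 := integrable_edgeTerm hβ hν₁
  have i2 := integrable_edgeTerm hβ hν₂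
  have i3 := integrable_messageGrad hβ hπ1 hd hν₁
  have g1 := integral_prod_symm _ i3
  have g2 : ∫ x, messageGrad β x.1 x.2 ∂(π.prod ν₁) =
      ∫ x : (ℝ × ℝ) × (ℝ × ℝ), messageGrad β x.1 x.2.1 ∂(π.prod π) := by
    rw [← m3]
    exact integral_map q3.aemeasurable (measurable_messageGrad β).aestronglyMeasurable
  have g3 := integral_prod_swap (μ := π) (ν := π)
    (fun x : (ℝ × ℝ) × (ℝ × ℝ) => messageGrad β x.1 x.2.1)
  rw [← m1] at i1
  rw [← m2] at i2
  rw [← m3] at i3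
  have i1' : Integrable (fun x => edgeTerm β (Prod.map Prod.fst Prod.fst x)) (π.prod π) :=
    i1.comp_measurable q1
  have i2' : Integrable (fun x => edgeTerm β (Prod.map Prod.snd Prod.snd x)) (π.prod π) :=
    i2.comp_measurable q2
  have i5 : Integrable (fun x => edgeTerm β (Prod.map Prod.snd Prod.snd x) -
      edgeTerm β (Prod.map Prod.fst Prod.fst x)) (π.prod π) := i2'.sub i1'
  have i3' : Integrable (fun x : (ℝ × ℝ) × (ℝ × ℝ) => messageGrad β x.1 x.2.1) (π.prod π) :=
    i3.comp_measurable q3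
  have i4' : Integrable (fun x : (ℝ × ℝ) × (ℝ × ℝ) => messageGrad β x.2 x.1.1) (π.prod π) :=
    i3'.swap
  have i6 : Integrable (fun x : (ℝ × ℝ) × (ℝ × ℝ) =>
      messageGrad β x.1 x.2.1 + messageGrad β x.2 x.1.1) (π.prod π) := i3'.add i4'
  have hlin : 2 * ∫ h, (∫ p, messageGrad β p h ∂π) ∂ν₁ =
      ∫ x : (ℝ × ℝ) × (ℝ × ℝ), (messageGrad β x.1 x.2.1 + messageGrad β x.2 x.1.1)
        ∂(π.prod π) := by
    rw [integral_add i3' i4', ← g1, g2, two_mul]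
    congr 1
    exact g3.symm
  rw [hlin, ← m1, ← m2,
    integral_map q1.aemeasurable (measurable_edgeTerm β).aestronglyMeasurable,
    integral_map q2.aemeasurable (measurable_edgeTerm β).aestronglyMeasurable,
    ← integral_sub i2' i1', ← integral_sub i5 i6, ← Real.norm_eq_abs]
  refine (norm_integral_le_of_norm_le_const (C := 5 * δ ^ 2) ?_).trans (by simp)
  have h1 := (Measure.quasiMeasurePreserving_fst (μ := π) (ν := π)).ae (hπ1.and (hπ2.and hd))
  have h2 := (Measure.quasiMeasurePreserving_snd (μ := π) (ν := π)).ae (hπ1.and (hπ2.and hd))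
  filter_upwards [h1, h2] with x hx hx'
  exact abs_edgeTerm_sub_le hβ hx.1 hx.2.1 hx'.1 hx'.2.1 hx.2.2 hx'.2.2

/-- The pressure functional is stationary at the fixed point, to order `τ - 1` in the distance of
the laws of `tanh h`. -/
theorem exists_abs_pressure_sub_le {P : PMF ℕ} {τ : ℝ} (hτ₂ : 2 < τ) (hτ₃ : τ < 3)
    (hP : StronglyFiniteMean P τ) : ∃ C : ℝ, 0 ≤ C ∧ ∀ {β B δ : ℝ} {ν₁ ν₂ : Measure ℝ}
      {π : Measure (ℝ × ℝ)}, 0 ≤ β → 0 ≤ B → IsTreeFixedPoint P β B ν₁ →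
      (∀ᵐ h ∂ν₂, 0 ≤ h) → IsCoupling π ν₁ ν₂ →
      (∀ᵐ p ∂π, |Real.tanh p.2 - Real.tanh p.1| ≤ δ) → 0 < δ →
      |pressure P ν₁ β B - pressure P ν₂ β B| ≤ C * δ ^ (τ - 1) := by
  obtain ⟨K, hK0, hK⟩ := hP.exists_tsum_min_le hτ₂ hτ₃
  have hs := hP.summable hτ₂
  have hmean : 0 ≤ degMean P := tsum_nonneg fun k => by positivity
  have main : ∀ {β B δ : ℝ} {ν₁ ν₂ : Measure ℝ} {π : Measure (ℝ × ℝ)}, 0 ≤ β → 0 ≤ B →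
      IsTreeFixedPoint P β B ν₁ → (∀ᵐ h ∂ν₂, 0 ≤ h) → IsCoupling π ν₁ ν₂ →
      (∀ᵐ p ∂π, |Real.tanh p.2 - Real.tanh p.1| ≤ δ) → 0 < δ → δ ≤ 1 →
      |pressure P ν₁ β B - pressure P ν₂ β B| ≤ (degMean P / 2 * 5 + 3 * K) * δ ^ (τ - 1) := by
    intro β B δ ν₁ ν₂ π hβ hB h₁ hν₂ hπ hd hδ hδ1
    obtain ⟨hsum, hle⟩ := hK δ hδ
    have hv := abs_integral_vertexTerm_sub_le hβ hB h₁ hν₂ hπ hs hd hsum hδ.le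
    have he := abs_integral_edgeTerm_sub_le hβ h₁.nonneg hν₂ hπ hd
    have hsq : δ ^ 2 ≤ δ ^ (τ - 1) := by
      rw [← Real.rpow_natCast]
      exact Real.rpow_le_rpow_of_exponent_ge hδ hδ1 (by push_cast; linarith)
    set V₁ := ∫ x, vertexTerm β B x ∂(P.toMeasure.prod (iidLaw ν₁)) with hV₁
    set V₂ := ∫ x, vertexTerm β B x ∂(P.toMeasure.prod (iidLaw ν₂)) with hV₂
    set E₁ := ∫ h, edgeTerm β h ∂(ν₁.prod ν₁) with hE₁
    set E₂ := ∫ h, edgeTerm β h ∂(ν₂.prod ν₂) with hE₂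
    set G := ∫ h, (∫ p, messageGrad β p h ∂π) ∂ν₁
    -- The cancellation: the first-order parts `degMean P / 2 * (2 * G)` and `degMean P * G` have
    -- opposite signs.
    have e : pressure P ν₁ β B - pressure P ν₂ β B =
        degMean P / 2 * (E₂ - E₁ - 2 * G) - (V₂ - V₁ - degMean P * G) := by
      rw [pressure, pressure, ← hV₁, ← hV₂, ← hE₁, ← hE₂]
      ring
    rw [e]
    refine (abs_sub _ _).trans ?_
    rw [abs_mul, abs_of_nonneg (by positivity : 0 ≤ degMean P / 2)]
    have h1 := mul_le_mul_of_nonneg_left (he.trans (mul_le_mul_of_nonneg_left hsq (by norm_num)))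
      (by positivity : 0 ≤ degMean P / 2)
    have h2 := hv.trans (mul_le_mul_of_nonneg_left hle (by norm_num))
    linarith
  refine ⟨degMean P / 2 * 5 + 3 * K, by positivity, ?_⟩
  intro β B δ ν₁ ν₂ π hβ hB h₁ hν₂ hπ hd hδ
  rcases le_total δ 1 with hδ1 | hδ1
  · exact main hβ hB h₁ hν₂ hπ hd hδ hδ1
  -- For `δ ≥ 1` the bound with distance `1` suffices, since `tanh` of nonnegative fields lies in
  -- `[0, 1)`.
  · have hd' : ∀ᵐ p ∂π, |Real.tanh p.2 - Real.tanh p.1| ≤ 1 := by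
      filter_upwards [hπ.ae_fst h₁.nonneg, hπ.ae_snd hν₂] with p hp₁ hp₂
      have a1 := tanh_nonneg' hp₁
      have a2 := tanh_nonneg' hp₂
      have a3 := Real.tanh_lt_one p.1
      have a4 := Real.tanh_lt_one p.2
      rw [abs_le]
      constructor <;> linarith
    refine (main hβ hB h₁ hν₂ hπ hd' one_pos le_rfl).trans ?_
    refine mul_le_mul_of_nonneg_left ?_ (by positivity)
    rw [Real.one_rpow]
    exact Real.one_le_rpow hδ1 (by linarith)

end PressureDifference

/-! ### Dependence on `β` and on `B` -/

/-- The bound for arbitrarily good couplings extends to the infimal distance. -/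
theorem le_mul_rpow_of_forall_add {x C s p : ℝ} (hp : 0 < p)
    (h : ∀ ε, 0 < ε → x ≤ C * (s + ε) ^ p) : x ≤ C * s ^ p := by
  have hc : Filter.Tendsto (fun ε : ℝ => C * (s + ε) ^ p) (nhdsWithin 0 (Set.Ioi 0))
      (nhds (C * (s + 0) ^ p)) := by
    refine Filter.Tendsto.mono_left (Continuous.tendsto ?_ 0) nhdsWithin_le_nhds
    exact continuous_const.mul ((continuous_const.add continuous_id).rpow_const
      fun _ => Or.inr hp.le)
  rw [add_zero] at hc
  refine ge_of_tendsto hc ?_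
  filter_upwards [self_mem_nhdsWithin] with ε hε using h ε hε

/-- Change of the message under a change of `β`, expressed as a rescaling of the field. -/
theorem message_le_of_abs_sub_le {b B β₁ β₂ s x : ℝ} (hb : 0 < b) (hB : 0 < B) (hβ₁ : b ≤ β₁)
    (hs : 0 ≤ s) (hs2 : s ≤ Real.log 2) (h : β₂ - β₁ ≤ s / messageConst b (B / 2)) (hx : B ≤ x) :
    message β₂ x ≤ Real.exp s * message β₁ (Real.exp (-s) * x) := by
  -- The restriction `s ≤ log 2` keeps the rescaled field above `B / 2`, the level at which
  -- `messageConst` is taken.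
  have hy : B / 2 ≤ Real.exp (-s) * x := by
    have h1 : (1 / 2 : ℝ) ≤ Real.exp (-s) := by
      have := Real.exp_le_exp.2 (neg_le_neg hs2)
      rwa [Real.exp_neg (Real.log 2), Real.exp_log two_pos, ← one_div] at this
    nlinarith
  have key := message_le_exp_mul_of_beta hb (half_pos hB) hβ₁ hy hs
  rw [← mul_assoc, ← Real.exp_add, add_neg_cancel, Real.exp_zero, one_mul] at key
  exact (message_mono_left (by linarith) (by linarith)).trans key

theorem exists_pressure_dependence_beta {P : PMF ℕ} {τ : ℝ} (hτ₂ : 2 < τ) (hτ₃ : τ < 3)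
    (hP : StronglyFiniteMean P τ) {B b : ℝ} (hB : 0 < B) (hb : 0 < b) :
    ∃ C : ℝ, ∀ β₁ β₂ : ℝ, b ≤ β₁ → b ≤ β₂ → ∀ ν₁ ν₂ : Measure ℝ,
      IsTreeFixedPoint P β₁ B ν₁ → IsTreeFixedPoint P β₂ B ν₂ →
      |pressure P ν₁ β₁ B - pressure P ν₂ β₁ B| ≤ C * |β₁ - β₂| ^ (τ - 1) := by
  obtain ⟨C, hC0, hC⟩ := exists_abs_pressure_sub_le hτ₂ hτ₃ hP
  set A := messageConst b (B / 2) with hA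
  have hA0 : 0 < A := messageConst_pos hb (half_pos hB)
  have hl : 0 < Real.log 2 := Real.log_pos one_lt_two
  -- The summand `A` serves the coupling regime `s ≤ log 2`; `A / log 2` makes the base at least `1`
  -- when `s ≥ log 2`, where the trivial distance `1` is enough.
  refine ⟨C * (A / Real.log 2 + A) ^ (τ - 1), fun β₁ β₂ hβ₁ hβ₂ ν₁ ν₂ h₁ h₂ => ?_⟩
  have hb₁ : 0 < β₁ := hb.trans_le hβ₁
  have hb₂ : 0 < β₂ := hb.trans_le hβ₂
  have hp := h₁.isProbabilityMeasure
  have hp' := h₂.isProbabilityMeasure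
  set s := A * |β₁ - β₂| with hs
  have hs0 : 0 ≤ s := by positivity
  rw [mul_assoc, ← Real.mul_rpow (by positivity) (abs_nonneg _)]
  have e : (A / Real.log 2 + A) * |β₁ - β₂| = s / Real.log 2 + s := by rw [hs]; ring
  rw [e]
  have hmono : ∀ t, 0 ≤ t → t ≤ s / Real.log 2 + s →
      C * t ^ (τ - 1) ≤ C * (s / Real.log 2 + s) ^ (τ - 1) := fun t ht hts =>
    mul_le_mul_of_nonneg_left (Real.rpow_le_rpow ht hts (by linarith)) hC0
  rcases le_total s (Real.log 2) with hsl | hsl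
  · have hsA : s / A = |β₁ - β₂| := by rw [hs]; field_simp
    refine le_trans (le_mul_rpow_of_forall_add (by linarith) fun ε hε => ?_)
      (hmono s hs0 (le_add_of_nonneg_left (by positivity)))
    have hexp : B ≤ Real.exp s * B := le_mul_of_one_le_left hB.le (Real.one_le_exp hs0)
    obtain ⟨π, hπ, hd⟩ := exists_coupling_tanh hb₁ hb₂ hB le_rfl le_rfl hs0 hexp hexp
      (fun x hx => message_le_of_abs_sub_le hb hB hβ₂ hs0 hsl
        (by rw [← hA, hsA]; exact le_abs_self _) hx)
      (fun x hx => message_le_of_abs_sub_le hb hB hβ₁ hs0 hsl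
        (by rw [← hA, hsA, abs_sub_comm]; exact le_abs_self _) hx) h₁ h₂ hε
    exact hC hb₁.le hB.le h₁ h₂.nonneg hπ hd (by linarith)
  · refine le_trans ?_ (hmono 1 zero_le_one ?_)
    · have hπ := isCoupling_prod ν₁ ν₂
      refine hC hb₁.le hB.le h₁ h₂.nonneg hπ ?_ one_pos
      filter_upwards [hπ.ae_fst h₁.nonneg, hπ.ae_snd h₂.nonneg] with p hp₁ hp₂
      have a1 := tanh_nonneg' hp₁
      have a2 := tanh_nonneg' hp₂
      have a3 := Real.tanh_lt_one p.1
      have a4 := Real.tanh_lt_one p.2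
      rw [abs_le]
      constructor <;> linarith
    · have : 1 ≤ s / Real.log 2 := by rwa [one_le_div hl]
      linarith

/-- At a common `β` only the fields change. Subhomogeneity of the message lets any `s ≥ 0` serve, so
`s = |B₁ - B₂| / m` works without a smallness restriction. -/
theorem exists_pressure_dependence_field {P : PMF ℕ} {τ : ℝ} (hτ₂ : 2 < τ) (hτ₃ : τ < 3)
    (hP : StronglyFiniteMean P τ) {β m : ℝ} (hβ : 0 < β) (hm : 0 < m) :
    ∃ C : ℝ, ∀ B₁ B₂ : ℝ, m ≤ B₁ → m ≤ B₂ → ∀ ν₁ ν₂ : Measure ℝ,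
      IsTreeFixedPoint P β B₁ ν₁ → IsTreeFixedPoint P β B₂ ν₂ →
      |pressure P ν₁ β B₁ - pressure P ν₂ β B₁| ≤ C * |B₁ - B₂| ^ (τ - 1) := by
  obtain ⟨C, hC0, hC⟩ := exists_abs_pressure_sub_le hτ₂ hτ₃ hP
  refine ⟨C * m⁻¹ ^ (τ - 1), fun B₁ B₂ hB₁ hB₂ ν₁ ν₂ h₁ h₂ => ?_⟩
  set s := m⁻¹ * |B₁ - B₂| with hs
  have hs0 : 0 ≤ s := by positivity
  rw [mul_assoc, ← Real.mul_rpow (by positivity) (abs_nonneg _), ← hs]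
  refine le_mul_rpow_of_forall_add (by linarith) fun ε hε => ?_
  have hexp : ∀ a a', m ≤ a' → a - a' ≤ |B₁ - B₂| → a ≤ Real.exp s * a' := by
    intro a a' ha' h
    have h1 : s * m = |B₁ - B₂| := by rw [hs]; field_simp
    have h2 := Real.add_one_le_exp s
    -- The chain is `a ≤ a' + s m ≤ (1 + s) a' ≤ e^s a'`.
    nlinarith [mul_le_mul_of_nonneg_left ha' hs0, mul_le_mul_of_nonneg_right h2 (hm.le.trans ha')]
  have hH : ∀ x, m ≤ x → message β x ≤ Real.exp s * message β (Real.exp (-s) * x) := by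
    intro x hx
    have hx0 : 0 < x := by linarith
    have key := message_le_exp_mul hβ (mul_pos (Real.exp_pos (-s)) hx0) hs0
    rwa [← mul_assoc, ← Real.exp_add, add_neg_cancel, Real.exp_zero, one_mul] at key
  obtain ⟨π, hπ, hd⟩ := exists_coupling_tanh hβ hβ hm hB₁ hB₂ hs0
    (hexp B₁ B₂ hB₂ (le_abs_self _))
    (hexp B₂ B₁ hB₁ (by rw [abs_sub_comm]; exact le_abs_self _)) hH hH h₁ h₂ hε
  exact hC hβ.le (hm.le.trans hB₁) h₁ h₂.nonneg hπ hd (by linarith)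

end RandomIsing

end

open RandomIsing in
theorem mainTheorem5 (P : PMF ℕ) (τ : ℝ) (hτ₂ : 2 < τ) (hτ₃ : τ < 3)
    (hP : StronglyFiniteMean P τ) :
    -- (a) dependence on `β` through the fixed point, at a common `B`
    (∀ B : ℝ, 0 < B → ∀ βmin : ℝ, 0 < βmin → ∃ C : ℝ, ∀ β₁ β₂ : ℝ, βmin ≤ β₁ → βmin ≤ β₂ →
      ∀ ν₁ ν₂ : MeasureTheory.Measure ℝ,
        IsTreeFixedPoint P β₁ B ν₁ → IsTreeFixedPoint P β₂ B ν₂ →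
        |pressure P ν₁ β₁ B - pressure P ν₂ β₁ B| ≤ C * |β₁ - β₂| ^ (τ - 1)) ∧
    -- (b) dependence on `B` through the fixed point, at a common `β`
    (∀ β : ℝ, 0 < β → ∀ Bmin : ℝ, 0 < Bmin → ∃ C : ℝ, ∀ B₁ B₂ : ℝ, Bmin ≤ B₁ → Bmin ≤ B₂ →
      ∀ ν₁ ν₂ : MeasureTheory.Measure ℝ,
        IsTreeFixedPoint P β B₁ ν₁ → IsTreeFixedPoint P β B₂ ν₂ →
        |pressure P ν₁ β B₁ - pressure P ν₂ β B₁| ≤ C * |B₁ - B₂| ^ (τ - 1)) := by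
  exact ⟨fun B hB b hb => exists_pressure_dependence_beta hτ₂ hτ₃ hP hB hb,
    fun β hβ m hm => exists_pressure_dependence_field hτ₂ hτ₃ hP hβ hm⟩
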